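/- Let $k$ be a global field with separable closure $k_s$, let $p$ be a prime and $e\ge 0$, and let $K_0\subset k_s$ be a cyclic extension of $k$ of degree $p^e$. Let $K_1,\dots,K_m\subset k_s$ be finite extensions of $k$ and $K'=\prod_{i=1}^m K_i$. Let $T=T_{K_0/k}$ be the norm-one torus, $T(R)=\{x\in (K_0\otimes_k R)^\times : N(x)=1\}$. For a field extension $F/k$ write $H^1(F,\widehat T)$ for the first Galois cohomology group of the character group of $T\otimes_k F=T_{(K_0\otimes_k F)/F}$, and for $F'/F$ let $b_{F'/F}\colon H^1(F,\widehat T)\to H^1(F',\widehat T)$ be the base change (restriction) map. Let $\Omega_k$ be the set of places of $k$ and let $$S(K_0,K')=\Big\{x\in\bigoplus_{i=1}^m H^1(K_i,\widehat T) : \forall v\in\Omega_k\ \exists y_v\in H^1(k_v,\widehat T)\ \forall i\ \forall w\mid v \text{ a place of } K_i:\ b_{K_{i,w}/K_i}(x_i)=b_{K_{i,w}/k_v}(y_v)\Big\}.$$ Put $M_i=K_0K_i$, $p^{e_i}=[M_i:K_i]$, $\bar e=\max_i e_i$ ($\bar e=0$ if $m=0$). For $v\in\Omega_k$ let $p^{e(v)}=[K_{0,\tilde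 v}:k_v]$ for any place $\tilde v\mid v$ of $K_0$; for a place $w\mid v$ of $K_i$ let $p^{e_i(w)}=[M_{i,\tilde w}:K_{i,w}]$ for any place $\tilde w\mid w$ of $M_i$; let $e_i(v)=\max_{w\mid v}e_i(w)$. For $a=(a_i)\in\bigoplus_i\mathbb Z/p^{e_i}\mathbb Z$ and $n\in\mathbb Z/p^{\bar e}\mathbb Z$ let $I_n(a)=\{i: n\equiv a_i \bmod p^{e_i}\}$, let $\delta(n,a_i)$ be the largest $r\le e_i$ with $n\equiv a_i \bmod p^r$, and let $\Omega(I_n(a))$ be the set of $v\in\Omega_k$ such that $e_i(w)\le\delta(n,a_i)$ for all $i\notin I_n(a)$ and all places $w\mid v$ of $K_i$. Let $$G(K_0,K')=\Big\{a\in\bigoplus_{i}\mathbb Z/p^{e_i}\mathbb Z : \bigcup_{n\in\mathbb Z/p^{\bar e}\mathbb Z}\Omega(I_n(a))=\Omega_k\Big\}.$$ Call $a$ locally diagonal at $v$ if there is $n\in\mathbb Z/p^{e(v)}\mathbb Z$ with $n\equiv a_i\bmod p^{e_i(v)}$ for all $i$. Let $\gamma\colon \mathrm{Hom}(\mathrm{Gal}(K_0/k),\mathbb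 Q/\mathbb Z)\to\mathbb Z/p^e\mathbb Z$ be an isomorphism, and let $\nu\colon H^1(k,\widehat T)\to \mathrm{Hom}(\mathrm{Gal}(K_0/k),\mathbb Q/\mathbb Z)$ be the natural isomorphism (given by the connecting maps of $0\to\mathbb Z\to\widehat{R_{K_0/k}\mathbb G_m}\to\widehat T\to 0$ and of $0\to\mathbb Z\to\mathbb Q\to\mathbb Q/\mathbb Z\to0$ into $H^2(k,\mathbb Z)$). Then $\gamma$ induces isomorphisms $\Phi_i\colon H^1(K_i,\widehat T)\to\mathbb Z/p^{e_i}\mathbb Z$ with $\Phi_i(b_{K_i/k}(x))=\gamma(\nu(x)) \bmod p^{e_i}$ for all $x\in H^1(k,\widehat T)$, the isomorphism $\bigoplus_i\Phi_i$ maps $S(K_0,K')$ onto $G(K_0,K')$, and $G(K_0,K')$ is the set of all $a\in\bigoplus_i\mathbb Z/p^{e_i}\mathbb Z$ that are locally diagonal at every $v\in\Omega_k$. -/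

import Mathlib

open scoped TensorProduct

universe u

namespace Multinorm

noncomputable section

/-! ### Global fields and places -/

/-- A global field: a number field, or a finite extension of `𝔽_p(t)` for some prime `p`. -/
def IsGlobalField (k : Type u) [Field k] : Prop :=
  NumberField k ∨
    ∃ (p : ℕ) (_ : Fact p.Prime) (_ : Algebra (RatFunc (ZMod p)) k), FunctionField (ZMod p) k

/-- Equivalence of nontrivial real absolute values. -/
def placeSetoid (k : Type u) [Field k] : Setoid {v : AbsoluteValue k ℝ // v.IsNontrivial} where
  r v w := v.1.IsEquiv w.1
  iseqv := ⟨fun _ => .refl _, fun h => h.symm, fun h h' => h.trans h'⟩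

/-- The set `Ω_k` of places of `k`: nontrivial real absolute values up to equivalence. -/
def Place (k : Type u) [Field k] : Type u := Quotient (placeSetoid k)

/-- A chosen absolute value in the class of a place. -/
def Place.abs {k : Type u} [Field k] (v : Place k) : AbsoluteValue k ℝ := (Quotient.out v).1

/-- The absolute values on `L` that restrict to `v` on `F`. If `v` is a nontrivial absolute value
and `L/F` is algebraic, each place of `L` above the place of `v` contains exactly one of them, so
this is the set of places of `L` above `v`. -/
structure PlaceOver {F : Type u} [Field F] (v : AbsoluteValue F ℝ) (L : Type u) [Field L]
    [Algebra F L] where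
  /-- The absolute value. -/
  abs : AbsoluteValue L ℝ
  liesOver : abs.LiesOver v

section Completion

variable {F L : Type u} [Field F] [Field L] [Algebra F L] {v : AbsoluteValue F ℝ}

theorem PlaceOver.isometry (w : PlaceOver v L) :
    Isometry (WithAbs.map v w.abs (algebraMap F L)) := by
  refine AddMonoidHomClass.isometry_of_norm _ fun x => ?_
  rw [WithAbs.norm_eq_apply_ofAbs, WithAbs.norm_eq_apply_ofAbs]
  exact DFunLike.congr_fun w.liesOver.comp_eq x.ofAbs

/-- The map `F_v → L_w` of completions for `w ∣ v`. -/
def PlaceOver.completionMap (w : PlaceOver v L) : v.Completion →+* w.abs.Completion :=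
  w.isometry.mapRingHom

instance PlaceOver.algebraCompletion (w : PlaceOver v L) :
    Algebra v.Completion w.abs.Completion := w.completionMap.toAlgebra

instance PlaceOver.isScalarTower {k : Type u} [Field k] [Algebra k F] [Algebra k L]
    [IsScalarTower k F L] (w : PlaceOver v L) :
    IsScalarTower k v.Completion w.abs.Completion := by
  refine .of_algebraMap_eq fun x => ?_
  change _ = w.completionMap _
  rw [UniformSpace.Completion.algebraMap_def, UniformSpace.Completion.algebraMap_def]
  refine Eq.trans ?_ (w.isometry.mapRingHom_coe _).symm
  simp [WithAbs.algebraMap_right_apply, ← IsScalarTower.algebraMap_apply k F L]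

end Completion

/-! ### The tori `R_{K/k} 𝔾_m` and `T_{K/k}` as group functors, and their characters -/

section Torus

variable (k K : Type u) [Field k] [CommRing K] [Algebra k K]

/-- The map `(R ⊗ K)ˣ → (R' ⊗ K)ˣ` induced by a homomorphism `R → R'` of `k`-algebras. -/
def unitsMap {R R' : Type u} [CommRing R] [Algebra k R] [CommRing R'] [Algebra k R']
    (f : R →ₐ[k] R') : (R ⊗[k] K)ˣ →* (R' ⊗[k] K)ˣ :=
  Units.map (Algebra.TensorProduct.map f (AlgHom.id k K)).toMonoidHom

/-- A group subfunctor of `R ↦ (R ⊗ K)ˣ` on commutative `k`-algebras. -/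
structure GroupFunctor where
  /-- The group of `R`-points. -/
  points : ∀ (R : Type u) [CommRing R] [Algebra k R], Subgroup (R ⊗[k] K)ˣ
  map_mem : ∀ {R R' : Type u} [CommRing R] [Algebra k R] [CommRing R'] [Algebra k R']
    (f : R →ₐ[k] R') (x : (R ⊗[k] K)ˣ), x ∈ points R → unitsMap k K f x ∈ points R'

/-- `T^K = R_{K/k} 𝔾_m`, with `R`-points `(R ⊗ K)ˣ`. -/
def weilTorus : GroupFunctor k K where
  points _ _ _ := ⊤
  map_mem _ _ _ := trivial

variable {k K} in
theorem norm_map [Module.Finite k K] {R R' : Type u} [CommRing R] [Algebra k R] [CommRing R']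
    [Algebra k R'] (f : R →ₐ[k] R') (x : R ⊗[k] K) :
    Algebra.norm R' (Algebra.TensorProduct.map f (AlgHom.id k K) x) = f (Algebra.norm R x) := by
  classical
  let b := Module.finBasis k K
  let B := Algebra.TensorProduct.basis R b
  let B' := Algebra.TensorProduct.basis R' b
  have key : ∀ x : R ⊗[k] K,
      Algebra.leftMulMatrix B' (Algebra.TensorProduct.map f (AlgHom.id k K) x) =
        (Algebra.leftMulMatrix B x).map f := by
    intro x
    induction x with
    | zero => ext; simp
    | add x y hx hy => rw [map_add, map_add, hx, hy, map_add]; ext; simp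
    | tmul r a =>
      ext i j
      simp [Algebra.leftMulMatrix_eq_repr_mul, B, B', Algebra.TensorProduct.basis_apply,
        Algebra.TensorProduct.basis_repr_tmul]
  rw [Algebra.norm_eq_matrix_det B', Algebra.norm_eq_matrix_det B, key]
  exact (f : R →+* R').map_det _ |>.symm

/-- The norm-one torus `T_{K/k}`, with `R`-points the elements of `(R ⊗ K)ˣ` whose norm to `R`
is `1`. -/
def normOneTorus [Module.Finite k K] : GroupFunctor k K where
  points R _ _ := (Units.map (Algebra.norm R : R ⊗[k] K →* R)).ker
  map_mem f x hx := by
    rw [MonoidHom.mem_ker, Units.ext_iff] at hx ⊢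
    have h := norm_map f (x : _ ⊗[k] K)
    simp only [Units.coe_map, Units.val_one] at hx ⊢
    rw [hx, map_one] at h
    exact h

variable {k K}

/-- A character over `Ω` of the group functor `T`: a homomorphism `T_Ω → 𝔾_{m,Ω}` of group
functors on commutative `Ω`-algebras. An `Ω`-algebra is given here as a commutative `k`-algebra `R`
with a `k`-homomorphism `φ : Ω → R`; its homomorphisms are the `k`-homomorphisms under `Ω`. -/
@[ext]
structure Character (T : GroupFunctor k K) (Ω : Type u) [Field Ω] [Algebra k Ω] where
  /-- The homomorphism `T(R) → Rˣ` for the `Ω`-algebra `(R, φ)`. -/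
  app : ∀ (R : Type u) [CommRing R] [Algebra k R], (Ω →ₐ[k] R) → T.points R →* Rˣ
  natural : ∀ {R R' : Type u} [CommRing R] [Algebra k R] [CommRing R'] [Algebra k R']
    (φ : Ω →ₐ[k] R) (f : R →ₐ[k] R') (x : T.points R),
    app R' (f.comp φ) ⟨unitsMap k K f x, T.map_mem f x x.2⟩ =
      Units.map f.toMonoidHom (app R φ x)

namespace Character

variable {T : GroupFunctor k K} {Ω : Type u} [Field Ω] [Algebra k Ω]

instance : Zero (Character T Ω) := ⟨⟨fun _ _ _ _ => 1, fun _ _ _ => by simp⟩⟩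
instance : Add (Character T Ω) :=
  ⟨fun a b => ⟨fun R _ _ φ => a.app R φ * b.app R φ, fun φ f x => by
    simp [a.natural, b.natural]⟩⟩
instance : Neg (Character T Ω) :=
  ⟨fun a => ⟨fun R _ _ φ => (a.app R φ)⁻¹, fun φ f x => by simp [a.natural]⟩⟩

theorem zero_app (R : Type u) [CommRing R] [Algebra k R] (φ : Ω →ₐ[k] R) :
    (0 : Character T Ω).app R φ = 1 := rfl
theorem add_app (a b : Character T Ω) (R : Type u) [CommRing R] [Algebra k R] (φ : Ω →ₐ[k] R) :
    (a + b).app R φ = a.app R φ * b.app R φ := rfl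
theorem neg_app (a : Character T Ω) (R : Type u) [CommRing R] [Algebra k R] (φ : Ω →ₐ[k] R) :
    (-a).app R φ = (a.app R φ)⁻¹ := rfl

/-- The character group `T̂` over `Ω`, written additively. -/
instance : AddCommGroup (Character T Ω) where
  add_assoc a b c := by ext; simp [add_app, mul_assoc]
  zero_add a := by ext; simp [add_app, zero_app]
  add_zero a := by ext; simp [add_app, zero_app]
  neg_add_cancel a := by ext; simp [add_app, neg_app, zero_app]
  add_comm a b := by ext; simp [add_app, mul_comm]
  nsmul := nsmulRec
  zsmul := zsmulRec

/-- Base change of characters along `j : Ω → Ω'`: the restriction of a homomorphism of functors on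
`Ω`-algebras to `Ω'`-algebras. -/
def map {Ω' : Type u} [Field Ω'] [Algebra k Ω'] (j : Ω →ₐ[k] Ω') :
    Character T Ω →+ Character T Ω' where
  toFun χ := ⟨fun R _ _ φ => χ.app R (φ.comp j), fun φ f x => by
    rw [AlgHom.comp_assoc]; exact χ.natural _ _ _⟩
  map_zero' := rfl
  map_add' _ _ := rfl

theorem map_map {Ω' Ω'' : Type u} [Field Ω'] [Algebra k Ω'] [Field Ω''] [Algebra k Ω'']
    (j : Ω →ₐ[k] Ω') (j' : Ω' →ₐ[k] Ω'') (χ : Character T Ω) :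
    map j' (map j χ) = map (j'.comp j) χ := rfl

/-- The action of `Gal(Ω/F)` on characters over `Ω`, `(σχ)(x) = σ(χ(σ⁻¹x))` on `Ω`-points. -/
instance {F : Type u} [Field F] [Algebra k F] [Algebra F Ω] [IsScalarTower k F Ω] :
    DistribMulAction Gal(Ω/F) (Character T Ω) where
  smul σ χ := map ((σ : Ω →ₐ[F] Ω).restrictScalars k) χ
  one_smul _ := rfl
  mul_smul _ _ _ := rfl
  smul_zero _ := rfl
  smul_add _ _ _ := rfl

theorem smul_def {F : Type u} [Field F] [Algebra k F] [Algebra F Ω] [IsScalarTower k F Ω]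
    (σ : Gal(Ω/F)) (χ : Character T Ω) :
    σ • χ = map ((σ : Ω →ₐ[F] Ω).restrictScalars k) χ := rfl

/-- Restriction of characters of `T^K` to the subtorus `T_{K/k}`. -/
def restrictNormOne [Module.Finite k K] (χ : Character (weilTorus k K) Ω) :
    Character (normOneTorus k K) Ω where
  app R _ _ φ := (χ.app R φ).comp (Subgroup.inclusion le_top)
  natural φ f x := χ.natural φ f ⟨x, trivial⟩

/-- The norm `T^K → 𝔾_m` as a character. -/
def normCharacter (k K Ω : Type u) [Field k] [CommRing K] [Algebra k K] [Field Ω] [Algebra k Ω]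
    [Module.Finite k K] : Character (weilTorus k K) Ω where
  app R _ _ _ := (Units.map (Algebra.norm R : R ⊗[k] K →* R)).comp (Subgroup.subtype _)
  natural φ f x := by
    ext
    exact norm_map f (x.1 : _ ⊗[k] K)

end Character

end Torus

/-! ### First cohomology of a topological group with discrete coefficients -/

section H1

variable (Γ : Type*) [Group Γ] [TopologicalSpace Γ] (M : Type*) [AddCommGroup M]
  [DistribMulAction Γ M]

/-- Continuous `1`-cocycles of `Γ` with values in the discrete module `M`. -/
def Z1 : AddSubgroup (Γ → M) where
  carrier := {c | IsLocallyConstant c ∧ ∀ σ τ, c (σ * τ) = c σ + σ • c τ}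
  zero_mem' := ⟨IsLocallyConstant.const 0, fun _ _ => by simp⟩
  add_mem' {a b} ha hb := ⟨ha.1.add hb.1, fun σ τ => by
    simp only [Pi.add_apply, ha.2, hb.2, smul_add]; abel⟩
  neg_mem' {a} ha := ⟨ha.1.neg, fun σ τ => by
    simp only [Pi.neg_apply, ha.2, smul_neg]; abel⟩

/-- The coboundaries `σ ↦ σm - m`. -/
def B1 : AddSubgroup (Γ → M) where
  carrier := {c | ∃ m : M, ∀ σ, c σ = σ • m - m}
  zero_mem' := ⟨0, fun _ => by simp⟩
  add_mem' := by
    rintro a b ⟨m, hm⟩ ⟨n, hn⟩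
    exact ⟨m + n, fun σ => by simp only [Pi.add_apply, hm, hn, smul_add]; abel⟩
  neg_mem' := by
    rintro a ⟨m, hm⟩
    exact ⟨-m, fun σ => by simp only [Pi.neg_apply, hm, smul_neg]; abel⟩

/-- `H¹(Γ, M)`. -/
def H1 : Type _ := Z1 Γ M ⧸ (B1 Γ M).addSubgroupOf (Z1 Γ M)

instance : AddCommGroup (H1 Γ M) :=
  inferInstanceAs (AddCommGroup (Z1 Γ M ⧸ (B1 Γ M).addSubgroupOf (Z1 Γ M)))

variable {Γ M} in
/-- The class of a cocycle. -/
def H1.mk : Z1 Γ M →+ H1 Γ M := QuotientAddGroup.mk' _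

end H1

/-! ### Galois cohomology of the character group of a norm-one torus -/

section Galois

/-- The restriction homomorphism `Γ_{F'} → Γ_F` attached to an extension `F'/F` and an
embedding `j : F_s → F'_s`; it is characterized by `j ∘ (galRestrict j σ) = σ ∘ j`. -/
def galRestrict {F F' : Type u} [Field F] [Field F'] [Algebra F F']
    (j : SeparableClosure F →ₐ[F] SeparableClosure F') :
    Gal(SeparableClosure F'/F') →* Gal(SeparableClosure F/F) :=
  letI := j.toRingHom.toAlgebra
  haveI : IsScalarTower F (SeparableClosure F) (SeparableClosure F') :=
    .of_algebraMap_eq fun x => (j.commutes x).symm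
  (AlgEquiv.restrictNormalHom (SeparableClosure F)).comp (AlgEquiv.restrictScalarsHom F)

theorem galRestrict_commutes {F F' : Type u} [Field F] [Field F'] [Algebra F F']
    (j : SeparableClosure F →ₐ[F] SeparableClosure F') (σ : Gal(SeparableClosure F'/F'))
    (x : SeparableClosure F) : j (galRestrict j σ x) = σ (j x) := by
  let := j.toRingHom.toAlgebra
  have : IsScalarTower F (SeparableClosure F) (SeparableClosure F') :=
    .of_algebraMap_eq fun x => (j.commutes x).symm
  exact AlgEquiv.restrictNormal_commutes (AlgEquiv.restrictScalars F σ) (SeparableClosure F) x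

theorem galRestrict_continuous {F F' : Type u} [Field F] [Field F'] [Algebra F F']
    (j : SeparableClosure F →ₐ[F] SeparableClosure F') : Continuous (galRestrict j) := by
  refine continuous_of_continuousAt_one _ (continuousAt_def.mpr fun A hA => ?_)
  rw [map_one, krullTopology_mem_nhds_one_iff] at hA
  obtain ⟨E, hE, hEA⟩ := hA
  rw [krullTopology_mem_nhds_one_iff]
  obtain ⟨s, hs⟩ := IntermediateField.essFiniteType_iff.1 (inferInstance : Algebra.EssFiniteType F E)
  refine ⟨IntermediateField.adjoin F' (j '' (s : Set (SeparableClosure F))), ?_, fun σ hσ => ?_⟩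
  · have : Finite (j '' (s : Set (SeparableClosure F))) := (s.finite_toSet.image j).to_subtype
    exact IntermediateField.finiteDimensional_adjoin fun x _ =>
      Algebra.IsIntegral.isIntegral (R := F') x
  · refine hEA ?_
    rw [SetLike.mem_coe, ← hs, IntermediateField.mem_fixingSubgroup_iff]
    have hle : IntermediateField.adjoin F (s : Set (SeparableClosure F)) ≤
        IntermediateField.fixedField (Subgroup.zpowers (galRestrict j σ)) := by
      rw [IntermediateField.adjoin_le_iff]
      intro x hx
      have h1 : galRestrict j σ x = x := by
        apply (j : SeparableClosure F →+* SeparableClosure F').injective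
        change j _ = j _
        rw [galRestrict_commutes]
        exact (IntermediateField.mem_fixingSubgroup_iff _ _).1 hσ _
          (IntermediateField.subset_adjoin _ _ ⟨x, hx, rfl⟩)
      rintro ⟨g, hg⟩
      change g x = x
      have hz : Subgroup.zpowers (galRestrict j σ) ≤
          MulAction.stabilizer Gal(SeparableClosure F/F) x := by
        rw [Subgroup.zpowers_le]; exact h1
      exact hz hg
    intro x hx
    exact (hle hx) ⟨_, Subgroup.mem_zpowers _⟩

theorem isScalarTower_sepClosure (k F F' : Type u) [Field k] [Field F] [Algebra k F] [Field F']
    [Algebra k F'] [Algebra F F'] [IsScalarTower k F F'] :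
    IsScalarTower k F (SeparableClosure F') := .of_algebraMap_eq fun x => by
  rw [IsScalarTower.algebraMap_apply k F' (SeparableClosure F'),
    IsScalarTower.algebraMap_apply F F' (SeparableClosure F'),
    IsScalarTower.algebraMap_apply k F F']

theorem map_galRestrict_smul {k K F F' : Type u} [Field k] [CommRing K] [Algebra k K] [Field F]
    [Algebra k F] [Field F'] [Algebra k F'] [Algebra F F'] [IsScalarTower k F F']
    [IsScalarTower k F (SeparableClosure F')] {T : GroupFunctor k K}
    (j : SeparableClosure F →ₐ[F] SeparableClosure F') (σ : Gal(SeparableClosure F'/F'))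
    (χ : Character T (SeparableClosure F)) :
    Character.map (j.restrictScalars k) (galRestrict j σ • χ) =
      σ • Character.map (j.restrictScalars k) χ := by
  rw [Character.smul_def, Character.smul_def, Character.map_map, Character.map_map]
  have h : (j.restrictScalars k).comp
      (((galRestrict j σ : Gal(SeparableClosure F/F)) :
        SeparableClosure F →ₐ[F] SeparableClosure F).restrictScalars k) =
      ((σ : SeparableClosure F' →ₐ[F'] SeparableClosure F').restrictScalars k).comp
        (j.restrictScalars k) := AlgHom.ext fun x => galRestrict_commutes j σ x
  rw [h]

variable (k K F : Type u) [Field k] [CommRing K] [Algebra k K] [Module.Finite k K]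
  [Field F] [Algebra k F]

/-- The character group of `T_{K/k} ⊗_k F` over `F_s`. Since
`R ⊗_F (F ⊗_k K) = R ⊗_k K` for every `F`-algebra `R`, this torus is `T_{(K ⊗_k F)/F}`. -/
abbrev CharGroup : Type _ := Character (normOneTorus k K) (SeparableClosure F)

/-- `H¹(F, T̂_{(K ⊗_k F)/F})`, the first Galois cohomology group of `Γ_F`. -/
def GalH1 : Type _ := H1 Gal(SeparableClosure F/F) (CharGroup k K F)

instance : AddCommGroup (GalH1 k K F) :=
  inferInstanceAs (AddCommGroup (H1 Gal(SeparableClosure F/F) (CharGroup k K F)))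

variable {k F}

/-- The map on cocycles attached to `F'/F` and an embedding `j : F_s → F'_s`. -/
def baseChangeZ1 {F' : Type u} [Field F'] [Algebra k F'] [Algebra F F'] [IsScalarTower k F F']
    (j : SeparableClosure F →ₐ[F] SeparableClosure F') :
    Z1 Gal(SeparableClosure F/F) (CharGroup k K F) →+
      Z1 Gal(SeparableClosure F'/F') (CharGroup k K F') :=
  haveI := isScalarTower_sepClosure k F F'
  { toFun c := ⟨fun σ => Character.map (j.restrictScalars k) (c.1 (galRestrict j σ)),
      (c.2.1.comp_continuous (galRestrict_continuous j)).comp _, fun σ τ => by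
        beta_reduce
        rw [map_mul, c.2.2, map_add, map_galRestrict_smul]⟩
    map_zero' := by ext1; funext σ; exact map_zero _
    map_add' a b := by ext1; funext σ; exact map_add _ _ _ }

/-- The base change map `b_{F'/F} : H¹(F, T̂) → H¹(F', T̂)`. It does not depend on the embedding
`F_s → F'_s` over `F`, and one is chosen. -/
def baseChange (F F' : Type u) [Field F] [Algebra k F] [Field F'] [Algebra k F'] [Algebra F F']
    [IsScalarTower k F F'] : GalH1 k K F →+ GalH1 k K F' :=
  QuotientAddGroup.map _ _ (baseChangeZ1 K (F := F) (F' := F') IsSepClosed.lift) (by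
    rintro c ⟨m, hm⟩
    have := isScalarTower_sepClosure k F F'
    generalize (IsSepClosed.lift : SeparableClosure F →ₐ[F] SeparableClosure F') = j
    refine ⟨Character.map (j.restrictScalars k) m, fun σ => ?_⟩
    have hm' : c.1 (galRestrict j σ) = galRestrict j σ • m - m := hm _
    change Character.map (j.restrictScalars k) (c.1 (galRestrict j σ)) = _
    rw [hm', map_sub, map_galRestrict_smul])

end Galois

/-! ### The group `S(K, K')` -/

section Selmer

variable (k K : Type u) [Field k] [CommRing K] [Algebra k K] [Module.Finite k K]
  {ι : Type*} (K' : ι → Type u) [∀ i, Field (K' i)] [∀ i, Algebra k (K' i)]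

/-- `S(K, K')` for `K' = ∏ K' i`; here `GalH1 k K F` is `H¹(F, T̂_{(K ⊗ F)/F})`, the localization
maps are base change maps, and so are the components of `ι¹` (the dual of the norm
`R_{K'/k}(T_{(K ⊗ K')/K'}) → T_{K/k}` followed by Shapiro's isomorphism). It consists of the elements of `⊕ᵢ H¹(K' i, T̂)` whose image in
`∏_v ⊕ᵢ ⊕_{w ∣ v} H¹((K' i)_w, T̂)` comes from `∏_v H¹(k_v, T̂)`. -/
def selmerGroup : AddSubgroup (∀ i, GalH1 k K (K' i)) where
  carrier := {x | ∃ y : ∀ v : Place k, GalH1 k K v.abs.Completion,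
    ∀ (v : Place k) (i : ι) (w : PlaceOver v.abs (K' i)),
      baseChange K (K' i) w.abs.Completion (x i) =
        baseChange K v.abs.Completion w.abs.Completion (y v)}
  zero_mem' := ⟨0, fun v i w => by simp only [Pi.zero_apply, map_zero]⟩
  add_mem' := by
    rintro a b ⟨y, hy⟩ ⟨z, hz⟩
    exact ⟨y + z, fun v i w => by simp only [Pi.add_apply, map_add, hy, hz]⟩
  neg_mem' := by
    rintro a ⟨y, hy⟩
    exact ⟨-y, fun v i w => by simp only [Pi.neg_apply, map_neg, hy]⟩

end Selmer

/-! ### The natural isomorphism `H¹(k, T̂_{K/k}) ≃ Hom(Gal(K/k), ℚ/ℤ)` -/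

/-- For `K/k` Galois, `x ∈ H¹(k, T̂_{K/k})` and `χ ∈ Hom(Gal(K/k), ℚ/ℤ)`: the connecting map
`H¹(k, T̂_{K/k}) → H²(k, ℤ)` of `0 → ℤ → T̂^K → T̂_{K/k} → 0` (where `1 ∈ ℤ` goes to the norm) and
the connecting map `H¹(k, ℚ/ℤ) → H²(k, ℤ)` of `0 → ℤ → ℚ → ℚ/ℤ → 0` send `x` and the inflation of
`χ` to the same class. This is spelled out on cochains: `x` is the class of a cocycle `c`, which
lifts to `b`, and `χ` lifts to `ψ`, such that `b` and `ψ` have the same coboundary `z`. -/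
def CorrespondsTo {k : Type u} [Field k] (K : IntermediateField k (SeparableClosure k))
    [FiniteDimensional k K] [Normal k K] (x : GalH1 k K k)
    (χ : Additive Gal(K/k) →+ AddCircle (1 : ℚ)) : Prop :=
  ∃ (c : Z1 Gal(SeparableClosure k/k) (CharGroup k K k))
    (b : Gal(SeparableClosure k/k) → Character (weilTorus k K) (SeparableClosure k))
    (ψ : Gal(SeparableClosure k/k) → ℚ)
    (z : Gal(SeparableClosure k/k) → Gal(SeparableClosure k/k) → ℤ),
    x = H1.mk c ∧ IsLocallyConstant b ∧ IsLocallyConstant ψ ∧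
    (∀ σ, (b σ).restrictNormOne = c.1 σ) ∧
    (∀ σ, (ψ σ : AddCircle (1 : ℚ)) = χ (Additive.ofMul (AlgEquiv.restrictNormalHom K σ))) ∧
    (∀ σ τ, b σ + σ • b τ - b (σ * τ) =
      z σ τ • Character.normCharacter k K (SeparableClosure k)) ∧
    (∀ σ τ, ψ σ + ψ τ - ψ (σ * τ) = (z σ τ : ℚ))

/-! ### The group `G(K₀, K')` -/

section GroupG

variable {k : Type u} [Field k] (p : ℕ) (K₀ : IntermediateField k (SeparableClosure k))
  {ι : Type*} (K' : ι → IntermediateField k (SeparableClosure k))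

/-- `M_i = K₀ K_i`, as an extension of `K_i`. -/
abbrev compositum (K₀ K₁ : IntermediateField k (SeparableClosure k)) :
    IntermediateField K₁ (SeparableClosure k) :=
  IntermediateField.extendScalars (le_sup_right : K₁ ≤ K₀ ⊔ K₁)

/-- The exponent `e_i` with `p ^ e_i = [M_i : K_i]`. -/
def globalExp (i : ι) : ℕ := padicValNat p (Module.finrank (K' i) (compositum K₀ (K' i)))

/-- The exponent `r` with `p ^ r = [L_w : F_v]` for the places `w ∣ v` of `L`, for a Galois
extension `L/F` of `p`-power degree (all `w ∣ v` have the same local degree, a power of `p`). -/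
def localExp {F : Type u} [Field F] (v : AbsoluteValue F ℝ) (L : Type u) [Field L]
    [Algebra F L] : ℕ :=
  ⨆ w : PlaceOver v L, padicValNat p (Module.finrank v.Completion w.abs.Completion)

/-- `e(v)`, with `p ^ e(v) = [K_{0,ṽ} : k_v]` for `ṽ ∣ v`. -/
def expAt (v : Place k) : ℕ := localExp p v.abs K₀

/-- `e_i(w)`, with `p ^ e_i(w) = [M_{i,w̃} : K_{i,w}]` for `w̃ ∣ w`. -/
def expOver {v : Place k} (i : ι) (w : PlaceOver v.abs (K' i)) : ℕ :=
  localExp p w.abs (compositum K₀ (K' i))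

/-- `e_i(v)`, the maximum of `e_i(w)` over the places `w ∣ v` of `K_i`. -/
def expMaxAt (v : Place k) (i : ι) : ℕ := ⨆ w : PlaceOver v.abs (K' i), expOver p K₀ K' i w

variable {p} in
/-- The projection `π_{s,t} : ℤ/p^s → ℤ/p^t`, for `t ≤ s`. -/
def proj {s : ℕ} (t : ℕ) (a : ZMod (p ^ s)) : ZMod (p ^ t) := a.cast

/-- The group `⊕ᵢ ℤ/p^{e_i}`. -/
abbrev SumZMod : Type _ := ∀ i : ι, ZMod (p ^ globalExp p K₀ K' i)

/-- The largest of the `e_i`, that is `e_1` if `e_1 ≥ e_2 ≥ … ≥ e_m`. -/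
def maxExp [Fintype ι] : ℕ := Finset.univ.sup (globalExp p K₀ K')

variable {p K₀ K'}

/-- `δ(n, a_i)`, the largest `r` with `n ≡ a_i mod p^r` (which makes sense for `r ≤ e_i`). -/
def delta [Fintype ι] (n : ZMod (p ^ maxExp p K₀ K')) (a : SumZMod p K₀ K') (i : ι) : ℕ :=
  sSup {r | r ≤ globalExp p K₀ K' i ∧ proj r n = proj r (a i)}

/-- `I_n(a)`, the set of `i` with `π(n) = a_i` in `ℤ/p^{e_i}`. -/
def indexSet [Fintype ι] (n : ZMod (p ^ maxExp p K₀ K')) (a : SumZMod p K₀ K') : Set ι :=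
  {i | proj (globalExp p K₀ K' i) n = a i}

/-- `Ω(I_n(a))`, the set of places `v` such that `e_i(w) ≤ δ(n, a_i)` for all `i ∉ I_n(a)` and
all places `w ∣ v` of `K_i`. -/
def omegaSet [Fintype ι] (n : ZMod (p ^ maxExp p K₀ K')) (a : SumZMod p K₀ K') :
    Set (Place k) :=
  {v | ∀ i ∉ indexSet n a, ∀ w : PlaceOver v.abs (K' i), expOver p K₀ K' i w ≤ delta n a i}

variable (p K₀ K') in
/-- `G(K₀, K')`, the set of `a ∈ ⊕ᵢ ℤ/p^{e_i}` such that the sets `Ω(I_n(a))` cover `Ω_k`. -/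
def groupG [Fintype ι] : Set (SumZMod p K₀ K') :=
  {a | ⋃ n : ZMod (p ^ maxExp p K₀ K'), omegaSet n a = Set.univ}

/-- `a` is locally diagonal at `v`: some `n ∈ ℤ/p^{e(v)}` satisfies `n ≡ a_i mod p^{e_i(v)}` for
all `i`. -/
def LocallyDiagonalAt (a : SumZMod p K₀ K') (v : Place k) : Prop :=
  ∃ n : ZMod (p ^ expAt p K₀ v), ∀ i,
    proj (expMaxAt p K₀ K' v i) n = proj (expMaxAt p K₀ K' v i) (a i)

end GroupG

end

end Multinorm

open Multinorm

/-!
Over a separably closed field the characters of `R_{K/k} 𝔾_m` are the functions to `ℤ` on the set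
of embeddings of `K`, and taking means maps `0 → ℤ → T̂^K → T̂ → 0` to `0 → ℤ → ℚ → ℚ/ℤ → 0`. Hence
the mean embeds `H¹(F, T̂)` into `Hom(Γ_F, ℚ/ℤ)`, and for `K = K₀` abelian over `k` its image
consists of the pullbacks of the characters of the image of `Γ_F` in `Gal(K₀/k)`. If `K₀/k` is
cyclic of degree `p^e`, then `H¹(F, T̂)` is the quotient `ℤ/p^r` of `ℤ/p^e`, where `p^r` is the
order of the image of `Γ_F`, and base change is reduction. For `F` one of `K_i`, `k_v` and `K_{i,w}`
the exponent `r` is `e_i`, `e(v)` or `e_i(w)`, and so both `S(K₀, K')` and `G(K₀, K')` are cut out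
by the solvability, for each `v`, of the congruences `n ≡ a_i mod p^{e_i(w)}`, which is local
diagonality at `v`.
-/

namespace Multinorm

noncomputable section

/-! ### Characters of the tori `R_{K/k} 𝔾_m` and `T_{K/k}` over a separably closed field -/

theorem exists_eq_single_of_isUnit {A M : Type*} [Semiring A] [NoZeroDivisors A] [Nontrivial A]
    [Group M] [TwoUniqueProds M] {a : MonoidAlgebra A M} (ha : IsUnit a) :
    ∃ m c, a = MonoidAlgebra.single m c := by
  classical
  obtain ⟨⟨a, b, hab, -⟩, rfl⟩ := ha
  have ha0 : a ≠ 0 := left_ne_zero_of_mul_eq_one hab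
  have hb0 : b ≠ 0 := right_ne_zero_of_mul_eq_one hab
  have card_pos {c : MonoidAlgebra A M} (hc : c ≠ 0) : 0 < c.coeff.support.card :=
    Finset.card_pos.2 (Finsupp.support_nonempty_iff.2 fun h => hc (MonoidAlgebra.ext h))
  have mul_eq_one {g h : M} (hgh : UniqueMul a.coeff.support b.coeff.support g h)
      (hg : g ∈ a.coeff.support) (hh : h ∈ b.coeff.support) : g * h = 1 := by
    by_contra hne
    refine mul_ne_zero (Finsupp.mem_support_iff.1 hg) (Finsupp.mem_support_iff.1 hh) ?_
    rw [← MonoidAlgebra.coeff_mul_mul_of_uniqueMul hgh, hab, MonoidAlgebra.one_def]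
    simp [MonoidAlgebra.coeff_single, Ne.symm hne]
  have hcard : a.coeff.support.card ≤ 1 := by
    by_contra! h
    obtain ⟨g, hg, h, hh, hne, hug, huh⟩ := TwoUniqueProds.uniqueMul_of_one_lt_card
      (A := a.coeff.support) (B := b.coeff.support) (by nlinarith [card_pos ha0, card_pos hb0])
    rw [Finset.mem_product] at hg hh
    have := hug hh.1 hh.2 ((mul_eq_one huh hh.1 hh.2).trans (mul_eq_one hug hg.1 hg.2).symm)
    exact hne (Prod.ext this.1.symm this.2.symm)
  obtain ⟨m, c, hm⟩ := Finsupp.card_support_le_one'.1 hcard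
  exact ⟨m, c, MonoidAlgebra.ext hm⟩

section Characters

variable {k K Ω : Type u} [Field k] [Field K] [Algebra k K] [Field Ω] [Algebra k Ω]
  {R : Type u} [CommRing R] [Algebra k R]

/-- The projection `R ⊗ K → R` attached to an embedding `x : K → Ω`, for an `Ω`-algebra `R`. -/
def tensorEval (φ : Ω →ₐ[k] R) (x : K →ₐ[k] Ω) : R ⊗[k] K →ₐ[R] R :=
  Algebra.TensorProduct.lift (AlgHom.id R R) (φ.comp x) fun _ _ => .all _ _

@[simp]
theorem tensorEval_tmul (φ : Ω →ₐ[k] R) (x : K →ₐ[k] Ω) (r : R) (a : K) :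
    tensorEval φ x (r ⊗ₜ a) = r * φ (x a) := by
  simp [tensorEval]

theorem tensorEval_map {R' : Type u} [CommRing R'] [Algebra k R'] (φ : Ω →ₐ[k] R)
    (f : R →ₐ[k] R') (x : K →ₐ[k] Ω) (u : R ⊗[k] K) :
    tensorEval (f.comp φ) x (Algebra.TensorProduct.map f (AlgHom.id k K) u) =
      f (tensorEval φ x u) := by
  induction u with
  | zero => simp
  | add a b ha hb => simp only [map_add, ha, hb]
  | tmul r a => simp

/-- The coordinate of `(R ⊗ K)ˣ` attached to an embedding `x : K → Ω`, for an `Ω`-algebra `R`. -/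
def unitsEval (φ : Ω →ₐ[k] R) (x : K →ₐ[k] Ω) : (R ⊗[k] K)ˣ →* Rˣ :=
  Units.map (tensorEval φ x : R ⊗[k] K →* R)

theorem unitsEval_unitsMap {R' : Type u} [CommRing R'] [Algebra k R'] (φ : Ω →ₐ[k] R)
    (f : R →ₐ[k] R') (x : K →ₐ[k] Ω) (u : (R ⊗[k] K)ˣ) :
    unitsEval (f.comp φ) x (unitsMap k K f u) = Units.map f.toMonoidHom (unitsEval φ x u) :=
  Units.ext (tensorEval_map φ f x u)

theorem unitsEval_comp {Ω' : Type u} [Field Ω'] [Algebra k Ω'] (φ : Ω' →ₐ[k] R)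
    (j : Ω →ₐ[k] Ω') (x : K →ₐ[k] Ω) : unitsEval (φ.comp j) x = unitsEval φ (j.comp x) :=
  rfl

/-- The group algebra over `Ω` of the lattice `ℤ ^ X`, for `X` the set of embeddings of `K` into
`Ω`: the coordinate ring of the split torus `R_{K/k} 𝔾_m` over `Ω`. -/
abbrev LaurentRing (k K Ω : Type u) [Field k] [Field K] [Algebra k K] [Field Ω] [Algebra k Ω] :
    Type u := MonoidAlgebra Ω ((K →ₐ[k] Ω) → Multiplicative ℤ)

/-- The structure map of the `Ω`-algebra `LaurentRing k K Ω`. -/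
def laurentAlg : Ω →ₐ[k] LaurentRing k K Ω := IsScalarTower.toAlgHom k Ω _

/-- The monomials of `LaurentRing k K Ω`, as units. -/
def laurentMon : ((K →ₐ[k] Ω) → Multiplicative ℤ) →* (LaurentRing k K Ω)ˣ :=
  (MonoidAlgebra.of Ω ((K →ₐ[k] Ω) → Multiplicative ℤ)).toHomUnits

theorem laurentMon_injective : Function.Injective (laurentMon (k := k) (K := K) (Ω := Ω)) :=
  fun _ _ h => MonoidAlgebra.of_injective (congrArg Units.val h)

open Classical in
/-- The coordinates of the split torus `R_{K/k} 𝔾_m` over `Ω`. -/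
def laurentVar (x : K →ₐ[k] Ω) : (LaurentRing k K Ω)ˣ :=
  laurentMon (Pi.mulSingle x (Multiplicative.ofAdd 1))

theorem laurentVar_zpow_injective (x : K →ₐ[k] Ω) :
    Function.Injective fun n : ℤ => laurentVar x ^ n := fun m n h => by
  simp only [laurentVar, ← map_zpow] at h
  simpa [← ofAdd_zsmul] using congrFun (laurentMon_injective h) x

variable [Module.Finite k K]

/-- The homomorphism from `LaurentRing k K Ω` with given values on the coordinates. -/
def laurentLift (φ : Ω →ₐ[k] R) (t : (K →ₐ[k] Ω) → Rˣ) : LaurentRing k K Ω →ₐ[k] R :=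
  MonoidAlgebra.liftNCAlgHom φ
    ((Units.coeHom R).comp (∏ x, ((zpowersHom Rˣ (t x)).comp (Pi.evalMonoidHom _ x))))
    fun _ _ => .all _ _

theorem laurentLift_single (φ : Ω →ₐ[k] R) (t : (K →ₐ[k] Ω) → Rˣ)
    (m : (K →ₐ[k] Ω) → Multiplicative ℤ) (c : Ω) :
    laurentLift φ t (MonoidAlgebra.single m c) =
      φ c * ((∏ x, t x ^ (m x).toAdd : Rˣ) : R) := by
  change MonoidAlgebra.liftNC _ _ _ = _
  rw [MonoidAlgebra.liftNC_single]
  simp [MonoidHom.finsetProd_apply, zpowersHom_apply]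

theorem laurentLift_comp_laurentAlg (φ : Ω →ₐ[k] R) (t : (K →ₐ[k] Ω) → Rˣ) :
    (laurentLift φ t).comp laurentAlg = φ := by
  ext c
  change laurentLift φ t (MonoidAlgebra.single 1 c) = _
  rw [laurentLift_single]
  simp

theorem laurentLift_laurentVar (φ : Ω →ₐ[k] R) (t : (K →ₐ[k] Ω) → Rˣ) (x : K →ₐ[k] Ω) :
    Units.map (laurentLift φ t).toMonoidHom (laurentVar x) = t x := by
  classical
  ext
  change laurentLift φ t (MonoidAlgebra.single _ 1) = _
  rw [laurentLift_single, Finset.prod_eq_single x]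
  · simp
  · intro y _ hy; simp [Pi.mulSingle_eq_of_ne hy]
  · simp

/-- The character `∏ x, x ^ f x` of `R_{K/k} 𝔾_m`. -/
def weilChar (f : (K →ₐ[k] Ω) → ℤ) : Character (weilTorus k K) Ω where
  app _ _ _ φ := (∏ x, unitsEval φ x ^ f x).comp (Subgroup.subtype _)
  natural φ g u := by simp [MonoidHom.finsetProd_apply, unitsEval_unitsMap]

theorem weilChar_app (f : (K →ₐ[k] Ω) → ℤ) (φ : Ω →ₐ[k] R) (u : (weilTorus k K).points R) :
    (weilChar f).app R φ u = ∏ x, unitsEval φ x u ^ f x := by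
  simp [weilChar, MonoidHom.finsetProd_apply]

theorem weilChar_add (f g : (K →ₐ[k] Ω) → ℤ) : weilChar (f + g) = weilChar f + weilChar g := by
  ext R _ _ φ u
  simp [Character.add_app, weilChar_app, zpow_add, Finset.prod_mul_distrib]

/-- `P` is a versal point: every point `u` of `T` is the image of `P` under the homomorphism given
by the coordinates of `u`. Since the units of the Laurent ring are monomials, the value of a
character at `P` is a monomial. -/
theorem exists_app_eq_prod {T : GroupFunctor k K} (χ : Character T Ω)
    (P : T.points (LaurentRing k K Ω))
    (hP : ∀ (R : Type u) [CommRing R] [Algebra k R] (φ : Ω →ₐ[k] R) (u : T.points R),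
      unitsMap k K (laurentLift φ fun x => unitsEval φ x u.1) P.1 = u) :
    ∃ f : (K →ₐ[k] Ω) → ℤ, ∀ (R : Type u) [CommRing R] [Algebra k R] (φ : Ω →ₐ[k] R)
      (u : T.points R), χ.app R φ u = ∏ x, unitsEval φ x u ^ f x := by
  obtain ⟨m, c, hmc⟩ := exists_eq_single_of_isUnit (χ.app _ laurentAlg P).isUnit
  have app_eq (R : Type u) [CommRing R] [Algebra k R] (φ : Ω →ₐ[k] R) (u : T.points R) :
      (χ.app R φ u : R) = φ c * ((∏ x, unitsEval φ x u ^ (m x).toAdd : Rˣ) : R) := by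
    let f : LaurentRing k K Ω →ₐ[k] R := laurentLift φ fun x => unitsEval φ x u
    have h := χ.natural laurentAlg f P
    have hu : (⟨unitsMap k K f P, T.map_mem f P P.2⟩ : T.points R) = u := Subtype.ext (hP R φ u)
    rw [laurentLift_comp_laurentAlg, hu] at h
    rw [h, ← laurentLift_single, ← hmc]
    rfl
  have hc : c = 1 := by simpa using (app_eq Ω (AlgHom.id k Ω) 1).symm
  exact ⟨fun x => (m x).toAdd, fun R _ _ φ u => Units.ext (by rw [app_eq, hc, map_one, one_mul])⟩

variable [Algebra.IsSeparable k K] [IsSepClosed Ω]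

variable (k K Ω) in
theorem card_embeddings : Fintype.card (K →ₐ[k] Ω) = Module.finrank k K :=
  AlgHom.card_of_splits k K Ω fun x =>
    IsSepClosed.splits_codomain _ (Algebra.IsSeparable.isSeparable k x)

instance nonempty_embeddings : Nonempty (K →ₐ[k] Ω) := ⟨IsSepClosed.lift⟩

theorem tensorEval_bijective (φ : Ω →ₐ[k] R) :
    Function.Bijective fun (u : R ⊗[k] K) (x : K →ₐ[k] Ω) => tensorEval φ x u := by
  classical
  let b : Module.Basis (K →ₐ[k] Ω) k K := (Module.finBasis k K).reindex
    (Fintype.equivOfCardEq (by simpa using (card_embeddings k K Ω).symm))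
  let M : Matrix (K →ₐ[k] Ω) (K →ₐ[k] Ω) Ω := .of fun x y => x (b y)
  -- Dedekind's independence of characters
  have hM : IsUnit M := by
    rw [← Matrix.linearIndependent_rows_iff_isUnit, Fintype.linearIndependent_iff]
    intro g hg
    refine Fintype.linearIndependent_iff.1 (linearIndependent_algHom_toLinearMap k K Ω) g ?_
    refine b.ext fun y => ?_
    simpa [M] using congrFun hg y
  have hbij : Function.Bijective (M.map φ).toLin' :=
    (Module.End.isUnit_iff _).1 ((hM.map φ.toRingHom.mapMatrix).map Matrix.toLinAlgEquiv')
  let B := Algebra.TensorProduct.basis R b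
  have heval : (fun (u : R ⊗[k] K) (x : K →ₐ[k] Ω) => tensorEval φ x u) =
      (M.map φ).toLin' ∘ B.equivFun := by
    funext u x
    obtain ⟨c, rfl⟩ := B.equivFun.symm.surjective u
    rw [Function.comp_apply, LinearEquiv.apply_symm_apply]
    simp [B, Module.Basis.equivFun_symm_apply, Matrix.mulVec, dotProduct, M,
      Algebra.TensorProduct.basis_apply, mul_comm]
  rw [heval]
  exact hbij.comp B.equivFun.bijective

/-- The splitting `R ⊗ K ≃ ∏ R` over the embeddings of `K` into `Ω`, for an `Ω`-algebra `R`. -/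
def tensorEquiv (φ : Ω →ₐ[k] R) : R ⊗[k] K ≃ₐ[R] ((K →ₐ[k] Ω) → R) :=
  AlgEquiv.ofBijective (AlgHom.pi fun x => tensorEval φ x) (tensorEval_bijective φ)

theorem norm_eq_prod_tensorEval (φ : Ω →ₐ[k] R) (u : R ⊗[k] K) :
    Algebra.norm R u = ∏ x, tensorEval φ x u := by
  classical
  have hdiag : Algebra.leftMulMatrix (Pi.basisFun R _) (tensorEquiv φ u) =
      Matrix.diagonal (tensorEquiv φ u) := by
    ext i j
    simp [Algebra.leftMulMatrix_eq_repr_mul, Matrix.diagonal_apply, Pi.single_apply]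
  rw [← Algebra.norm_eq_of_algEquiv (tensorEquiv φ),
    Algebra.norm_eq_matrix_det (Pi.basisFun R _), hdiag, Matrix.det_diagonal]
  rfl

/-- The point of `R_{K/k} 𝔾_m` over an `Ω`-algebra with given coordinates. -/
def unitsPoint (φ : Ω →ₐ[k] R) (t : (K →ₐ[k] Ω) → Rˣ) : (R ⊗[k] K)ˣ :=
  Units.map ((tensorEquiv (K := K) φ).symm : ((K →ₐ[k] Ω) → R) →* R ⊗[k] K)
    (MulEquiv.piUnits.symm t)

@[simp]
theorem unitsEval_unitsPoint (φ : Ω →ₐ[k] R) (t : (K →ₐ[k] Ω) → Rˣ) (x : K →ₐ[k] Ω) :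
    unitsEval φ x (unitsPoint φ t) = t x := by
  ext
  change tensorEquiv φ ((tensorEquiv φ).symm (MulEquiv.piUnits.symm t).1) x = _
  rw [AlgEquiv.apply_symm_apply]
  rfl

theorem units_ext_eval (φ : Ω →ₐ[k] R) {u v : (R ⊗[k] K)ˣ}
    (h : ∀ x, unitsEval φ x u = unitsEval φ x v) : u = v :=
  Units.ext ((tensorEval_bijective φ).1 (funext fun x => congrArg Units.val (h x)))

theorem mem_normOneTorus_iff (φ : Ω →ₐ[k] R) (u : (R ⊗[k] K)ˣ) :
    u ∈ (normOneTorus k K).points R ↔ ∏ x, unitsEval φ x u = 1 := by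
  change Units.map (Algebra.norm R : R ⊗[k] K →* R) u = 1 ↔ _
  rw [Units.ext_iff, Units.ext_iff, Units.coe_prod, Units.coe_map]
  exact Eq.congr_left (norm_eq_prod_tensorEval φ _)

theorem unitsMap_laurentLift_unitsPoint (φ : Ω →ₐ[k] R) (t : (K →ₐ[k] Ω) → Rˣ)
    (s : (K →ₐ[k] Ω) → (LaurentRing k K Ω)ˣ) :
    unitsMap k K (laurentLift φ t) (unitsPoint laurentAlg s) =
      unitsPoint φ fun x => Units.map (laurentLift φ t).toMonoidHom (s x) := by
  refine units_ext_eval φ fun x => ?_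
  have h := unitsEval_unitsMap laurentAlg (laurentLift φ t) x (unitsPoint laurentAlg s)
  rwa [laurentLift_comp_laurentAlg, unitsEval_unitsPoint,
    ← unitsEval_unitsPoint φ (fun x => Units.map (laurentLift φ t).toMonoidHom (s x))] at h

theorem weilChar_one : weilChar 1 = Character.normCharacter k K Ω := by
  ext R _ _ φ u
  rw [weilChar_app]
  simp only [Pi.one_apply, zpow_one, Units.coe_prod]
  exact (norm_eq_prod_tensorEval φ _).symm

theorem weilChar_surjective : Function.Surjective (weilChar (k := k) (K := K) (Ω := Ω)) := by
  intro χ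
  obtain ⟨f, hf⟩ := exists_app_eq_prod χ ⟨unitsPoint laurentAlg laurentVar, trivial⟩
    fun R _ _ φ u => by
      rw [unitsMap_laurentLift_unitsPoint]
      exact units_ext_eval φ fun x => by rw [unitsEval_unitsPoint, laurentLift_laurentVar]
  refine ⟨f, ?_⟩
  ext R _ _ φ u
  rw [hf, weilChar_app]

theorem weilChar_injective : Function.Injective (weilChar (k := k) (K := K) (Ω := Ω)) := by
  classical
  intro f g h
  funext y
  have eval_single (f : (K →ₐ[k] Ω) → ℤ) : (weilChar f).app (LaurentRing k K Ω) laurentAlg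
      ⟨unitsPoint laurentAlg (Pi.mulSingle y (laurentVar y)), trivial⟩ = laurentVar y ^ f y := by
    simp only [weilChar_app, unitsEval_unitsPoint]
    rw [Fintype.prod_eq_single y fun x hx => by simp [Pi.mulSingle_eq_of_ne hx],
      Pi.mulSingle_eq_same]
  apply laurentVar_zpow_injective y
  simp only [← eval_single, h]

/-- The character lattice of `R_{K/k} 𝔾_m` over `Ω`. -/
def weilCharEquiv : ((K →ₐ[k] Ω) → ℤ) ≃+ Character (weilTorus k K) Ω :=
  { Equiv.ofBijective weilChar ⟨weilChar_injective, weilChar_surjective⟩ with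
    map_add' := weilChar_add }

theorem weilCharEquiv_one : weilCharEquiv 1 = Character.normCharacter k K Ω := weilChar_one

/-- Restriction of characters from `R_{K/k} 𝔾_m` to the norm-one torus, as a homomorphism. -/
def restrictHom {k K Ω : Type u} [Field k] [Field K] [Algebra k K] [Module.Finite k K] [Field Ω]
    [Algebra k Ω] : Character (weilTorus k K) Ω →+ Character (normOneTorus k K) Ω where
  toFun := Character.restrictNormOne
  map_zero' := rfl
  map_add' _ _ := rfl

theorem restrictHom_smul {k K Ω F : Type u} [Field k] [Field K] [Algebra k K] [Module.Finite k K]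
    [Field Ω] [Algebra k Ω] [Field F] [Algebra k F] [Algebra F Ω] [IsScalarTower k F Ω]
    (σ : Gal(Ω/F)) (χ : Character (weilTorus k K) Ω) :
    restrictHom (σ • χ) = σ • restrictHom χ := rfl

theorem restrictHom_surjective :
    Function.Surjective (restrictHom (k := k) (K := K) (Ω := Ω)) := by
  classical
  intro χ
  obtain ⟨x₀⟩ : Nonempty (K →ₐ[k] Ω) := inferInstance
  -- the generic point of the norm-one torus: solve `∏ x, t x = 1` for the coordinate `t x₀`
  let t : (K →ₐ[k] Ω) → (LaurentRing k K Ω)ˣ :=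
    Function.update laurentVar x₀ (∏ x ∈ Finset.univ.erase x₀, laurentVar x)⁻¹
  have ht : ∏ x, t x = 1 := by
    rw [← Finset.mul_prod_erase _ _ (Finset.mem_univ x₀),
      Finset.prod_congr rfl fun x hx => Function.update_of_ne (Finset.ne_of_mem_erase hx) _ _]
    simp [t]
  obtain ⟨f, hf⟩ := exists_app_eq_prod χ ⟨unitsPoint laurentAlg t,
      (mem_normOneTorus_iff laurentAlg _).2 (by simpa using ht)⟩ fun R _ _ φ u => by
    rw [unitsMap_laurentLift_unitsPoint]
    refine units_ext_eval φ fun x => ?_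
    rw [unitsEval_unitsPoint]
    rcases eq_or_ne x x₀ with rfl | hx
    · simp only [t, Function.update_self, map_inv, map_prod, laurentLift_laurentVar]
      rw [inv_eq_iff_mul_eq_one, mul_comm, Finset.mul_prod_erase _ (unitsEval φ · u.1)
        (Finset.mem_univ x)]
      exact (mem_normOneTorus_iff φ u.1).1 u.2
    · simp only [t, Function.update_of_ne hx, laurentLift_laurentVar]
  refine ⟨weilChar f, ?_⟩
  ext R _ _ φ u
  rw [hf]
  exact congrArg Units.val (weilChar_app f φ _)

theorem eq_of_restrictHom_weilChar_eq_zero {f : (K →ₐ[k] Ω) → ℤ}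
    (h : restrictHom (weilChar f) = 0) (x y : K →ₐ[k] Ω) : f x = f y := by
  classical
  -- the point of the norm-one torus with coordinates `u` at `x` and `u⁻¹` at `y`
  let t : (K →ₐ[k] Ω) → (LaurentRing k K Ω)ˣ :=
    Pi.mulSingle x (laurentVar x) * Pi.mulSingle y (laurentVar x)⁻¹
  have prod_zpow (g : (K →ₐ[k] Ω) → ℤ) : ∏ z, t z ^ g z = laurentVar x ^ (g x - g y) := by
    simp only [t, Pi.mul_apply, mul_zpow, Finset.prod_mul_distrib]
    rw [Fintype.prod_eq_single x fun z hz => by simp [Pi.mulSingle_eq_of_ne hz],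
      Fintype.prod_eq_single y fun z hz => by simp [Pi.mulSingle_eq_of_ne hz]]
    simp [zpow_sub]
  have ht : unitsPoint laurentAlg t ∈ (normOneTorus k K).points (LaurentRing k K Ω) :=
    (mem_normOneTorus_iff laurentAlg _).2 (by simpa using prod_zpow 1)
  have happ : (weilChar f).app _ laurentAlg ⟨unitsPoint laurentAlg t, trivial⟩ = 1 :=
    congrArg (fun χ => χ.app _ laurentAlg ⟨unitsPoint laurentAlg t, ht⟩) h
  simp only [weilChar_app, unitsEval_unitsPoint, prod_zpow] at happ
  exact sub_eq_zero.1 (laurentVar_zpow_injective x (happ.trans (zpow_zero _).symm))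

theorem restrictHom_eq_zero_iff {χ : Character (weilTorus k K) Ω} :
    restrictHom χ = 0 ↔ ∃ n : ℤ, χ = n • Character.normCharacter k K Ω := by
  constructor
  · intro h
    obtain ⟨f, rfl⟩ := weilChar_surjective χ
    obtain ⟨x⟩ : Nonempty (K →ₐ[k] Ω) := inferInstance
    refine ⟨f x, ?_⟩
    rw [← weilCharEquiv_one, ← map_zsmul]
    exact congrArg weilChar (funext fun y => by
      simp [eq_of_restrictHom_weilChar_eq_zero h y x])
  · rintro ⟨n, rfl⟩
    rw [map_zsmul, show restrictHom (Character.normCharacter k K Ω) = 0 from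
      Character.ext (funext fun _ => funext fun _ => funext fun _ => funext fun _ =>
        MonoidHom.ext fun u => u.2), smul_zero]

end Characters

/-! ### The mean of a character -/

theorem coe_addCircle_one_eq_zero_iff {q : ℚ} : (q : AddCircle (1 : ℚ)) = 0 ↔ ∃ n : ℤ, n = q := by
  simp only [AddCircle.coe_eq_zero_iff, zsmul_one]

section Mean

variable {k K Ω : Type u} [Field k] [Field K] [Algebra k K] [Module.Finite k K]
  [Algebra.IsSeparable k K] [Field Ω] [Algebra k Ω] [IsSepClosed Ω]
  {Ω' : Type u} [Field Ω'] [Algebra k Ω'] [IsSepClosed Ω']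

/-- Composition with `j : Ω → Ω'` as a bijection between the embeddings of `K` into the separably
closed fields `Ω` and `Ω'`. -/
def embEquiv (j : Ω →ₐ[k] Ω') : (K →ₐ[k] Ω) ≃ (K →ₐ[k] Ω') :=
  .ofBijective j.comp <| (Fintype.bijective_iff_injective_and_card _).2
    ⟨fun _ _ h => AlgHom.cancel_left j.injective |>.1 h, by rw [card_embeddings, card_embeddings]⟩

theorem map_weilChar (j : Ω →ₐ[k] Ω') (f : (K →ₐ[k] Ω) → ℤ) :
    Character.map j (weilChar f) = weilChar (f ∘ (embEquiv j).symm) := by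
  ext R _ _ φ u
  change ((weilChar f).app R (φ.comp j) u : R) = _
  rw [weilChar_app, weilChar_app]
  congr 1
  refine Fintype.prod_equiv (embEquiv j) _ _ fun x => ?_
  rw [Function.comp_apply, Equiv.symm_apply_apply, unitsEval_comp]
  rfl

/-- The mean of the exponents `f x` of a character `∏ x, x ^ f x` of `R_{K/k} 𝔾_m`. -/
def weilMean : Character (weilTorus k K) Ω →+ ℚ :=
  (AddMonoidHom.mk' (fun f : (K →ₐ[k] Ω) → ℤ => (∑ x, (f x : ℚ)) / Module.finrank k K)
    fun f g => by simp [Finset.sum_add_distrib, add_div]).comp weilCharEquiv.symm.toAddMonoidHom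

theorem weilMean_weilChar (f : (K →ₐ[k] Ω) → ℤ) :
    weilMean (weilChar f) = (∑ x, (f x : ℚ)) / Module.finrank k K := by
  change (∑ x, ((weilCharEquiv.symm (weilCharEquiv f) x : ℤ) : ℚ)) / _ = _
  rw [AddEquiv.symm_apply_apply]

theorem weilMean_normCharacter : weilMean (Character.normCharacter k K Ω) = 1 := by
  have : (Module.finrank k K : ℚ) ≠ 0 := Nat.cast_ne_zero.2 Module.finrank_pos.ne'
  rw [← weilChar_one, weilMean_weilChar]
  simp [card_embeddings, this]

theorem weilMean_map (j : Ω →ₐ[k] Ω') (χ : Character (weilTorus k K) Ω) :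
    weilMean (Character.map j χ) = weilMean χ := by
  obtain ⟨f, rfl⟩ := weilChar_surjective χ
  rw [map_weilChar, weilMean_weilChar, weilMean_weilChar]
  exact congrArg (· / _) ((embEquiv j).symm.sum_comp fun x => (f x : ℚ))

theorem eq_of_restrictHom_eq_of_weilMean_eq {χ χ' : Character (weilTorus k K) Ω}
    (hr : restrictHom χ = restrictHom χ') (hm : weilMean χ = weilMean χ') : χ = χ' := by
  rw [← sub_eq_zero, ← map_sub] at hr hm
  obtain ⟨n, hn⟩ := restrictHom_eq_zero_iff.1 hr
  rw [hn, map_zsmul, weilMean_normCharacter, zsmul_one, Int.cast_eq_zero] at hm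
  rw [← sub_eq_zero, hn, hm, zero_smul]

/-- The mean modulo `ℤ` of the exponents of a character of the norm-one torus. It is well defined
since the exponents are determined up to a common integer. -/
def mean : Character (normOneTorus k K) Ω →+ AddCircle (1 : ℚ) :=
  restrictHom.liftOfSurjective restrictHom_surjective
    ⟨(QuotientAddGroup.mk' _).comp weilMean, fun χ hχ => by
      obtain ⟨n, rfl⟩ := restrictHom_eq_zero_iff.1 hχ
      rw [AddMonoidHom.mem_ker, AddMonoidHom.comp_apply, map_zsmul, weilMean_normCharacter]
      exact coe_addCircle_one_eq_zero_iff.2 ⟨n, by simp⟩⟩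

theorem mean_restrictHom (χ : Character (weilTorus k K) Ω) :
    mean (restrictHom χ) = (weilMean χ : AddCircle (1 : ℚ)) :=
  AddMonoidHom.liftOfRightInverse_comp_apply _ _ _ _ χ

theorem mean_map (j : Ω →ₐ[k] Ω') (χ : Character (normOneTorus k K) Ω) :
    mean (Character.map j χ) = mean χ := by
  obtain ⟨χ, rfl⟩ := restrictHom_surjective χ
  rw [mean_restrictHom, ← weilMean_map j, ← mean_restrictHom]
  rfl

theorem exists_restrictHom_eq_of_mean_eq_zero {χ : Character (normOneTorus k K) Ω}
    (h : mean χ = 0) : ∃ χ', restrictHom χ' = χ ∧ weilMean χ' = 0 := by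
  obtain ⟨χ, rfl⟩ := restrictHom_surjective χ
  rw [mean_restrictHom] at h
  obtain ⟨n, hn⟩ := coe_addCircle_one_eq_zero_iff.1 h
  refine ⟨χ - n • Character.normCharacter k K Ω, ?_, ?_⟩
  · rw [map_sub, restrictHom_eq_zero_iff.2 ⟨n, rfl⟩, sub_zero]
  · simp [weilMean_normCharacter, hn]

instance : IsAddTorsionFree (Character (normOneTorus k K) Ω) :=
  .of_not_isOfFinAddOrder fun χ hχ hfin => by
    obtain ⟨n, hn, hnχ⟩ := isOfFinAddOrder_iff_nsmul_eq_zero.1 hfin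
    obtain ⟨χ, rfl⟩ := restrictHom_surjective χ
    obtain ⟨f, rfl⟩ := weilChar_surjective χ
    obtain ⟨x⟩ : Nonempty (K →ₐ[k] Ω) := inferInstance
    rw [← map_nsmul, show n • weilChar f = weilChar (n • f) from
      (map_nsmul weilCharEquiv n f).symm] at hnχ
    refine hχ (restrictHom_eq_zero_iff.2 ⟨f x, ?_⟩)
    rw [← weilCharEquiv_one, ← map_zsmul]
    refine congrArg weilChar (funext fun y => ?_)
    simpa [hn.ne'] using eq_of_restrictHom_weilChar_eq_zero hnχ y x

section GaloisAction

variable {F : Type u} [Field F] [Algebra k F] [Algebra F Ω] [IsScalarTower k F Ω]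

theorem smul_weilChar (σ : Gal(Ω/F)) (f : (K →ₐ[k] Ω) → ℤ) :
    σ • weilChar f =
      weilChar (f ∘ (embEquiv ((σ : Ω →ₐ[F] Ω).restrictScalars k)).symm) :=
  map_weilChar _ f

theorem weilMean_smul (σ : Gal(Ω/F)) (χ : Character (weilTorus k K) Ω) :
    weilMean (σ • χ) = weilMean χ := weilMean_map _ χ

theorem mean_smul (σ : Gal(Ω/F)) (χ : Character (normOneTorus k K) Ω) :
    mean (σ • χ) = mean χ := mean_map _ χ

end GaloisAction

end Mean

/-! ### The connecting map `H¹(F, T̂) → Hom(Γ_F, ℚ/ℤ)` -/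

section FiniteRange

theorem eq_zero_of_finite_range {A B : Type*} [AddGroup A] [AddGroup B] [IsAddTorsionFree B]
    {f : A →+ B} (hf : (Set.range f).Finite) : f = 0 := by
  have : Finite f.range := hf
  ext a
  have h := isOfFinAddOrder_of_finite (⟨f a, a, rfl⟩ : f.range)
  exact (isOfFinAddOrder_iff_eq_zero _).1 (AddSubmonoid.isOfFinAddOrder_coe.2 h)

/-- The multiple is the number of values of the cocycle, and `q` is the sum of these values, which
`v ↦ σ • v + c σ` permutes. -/
theorem exists_nsmul_eq_sub_smul {Γ V : Type*} [Group Γ] [AddCommGroup V] [DistribMulAction Γ V]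
    {c : Γ → V} (hc : ∀ σ τ, c (σ * τ) = c σ + σ • c τ) (hfin : (Set.range c).Finite) :
    ∃ (n : ℕ) (q : V), n ≠ 0 ∧ ∀ σ, n • c σ = q - σ • q := by
  classical
  let O : Finset V := hfin.toFinset
  have mem_O {v : V} : v ∈ O ↔ ∃ σ, c σ = v := by simp [O]
  refine ⟨O.card, ∑ v ∈ O, v, Finset.card_ne_zero.2 ⟨c 1, mem_O.2 ⟨1, rfl⟩⟩, fun σ => ?_⟩
  have hinj : Function.Injective fun v : V => σ • v + c σ := fun a b h =>
    MulAction.injective σ (add_right_cancel h)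
  have himg : O.image (fun v => σ • v + c σ) = O := by
    refine Finset.eq_of_subset_of_card_le (fun v hv => ?_)
      (Finset.card_image_of_injective _ hinj).ge
    obtain ⟨w, hw, rfl⟩ := Finset.mem_image.1 hv
    obtain ⟨τ, rfl⟩ := mem_O.1 hw
    exact mem_O.2 ⟨σ * τ, by rw [hc, add_comm]⟩
  have hsum : ∑ v ∈ O, v = ∑ v ∈ O, (σ • v + c σ) := by
    conv_lhs => rw [← himg]
    exact Finset.sum_image hinj.injOn
  rw [Finset.sum_add_distrib, Finset.sum_const, ← Finset.smul_sum] at hsum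
  exact eq_sub_of_add_eq' hsum.symm

end FiniteRange

section Connecting

variable {k K F : Type u} [Field k] [Field K] [Algebra k K] [Module.Finite k K]
  [Algebra.IsSeparable k K] [Field F] [Algebra k F]

variable (k K F) in
/-- The composite of `H¹(F, T̂) → H²(F, ℤ)`, the connecting map of `0 → ℤ → T̂^K → T̂ → 0`, and
`H²(F, ℤ) ≃ Hom(Γ_F, ℚ/ℤ)`. The mean of exponents maps `0 → ℤ → T̂^K → T̂ → 0` to
`0 → ℤ → ℚ → ℚ/ℤ → 0`, and so this composite sends the class of a cocycle `c` to `mean ∘ c`. -/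
def connecting :
    GalH1 k K F →+ (Additive Gal(SeparableClosure F/F) →+ AddCircle (1 : ℚ)) :=
  QuotientAddGroup.lift _
    (AddMonoidHom.mk' (fun c => AddMonoidHom.mk' (fun σ => mean (c.1 σ.toMul)) fun σ τ => by
        rw [toMul_add, c.2.2, map_add, mean_smul])
      fun c d => AddMonoidHom.ext fun σ => map_add mean (c.1 σ.toMul) (d.1 σ.toMul))
    fun c ⟨m, hm⟩ => AddMonoidHom.ext fun σ => by
      have h : c.1 σ.toMul = σ.toMul • m - m := hm _
      change mean (c.1 σ.toMul) = 0
      rw [h, map_sub, mean_smul, sub_self]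

theorem connecting_baseChange {F' : Type u} [Field F'] [Algebra k F'] [Algebra F F']
    [IsScalarTower k F F'] (x : GalH1 k K F) :
    connecting k K F' (baseChange K F F' x) =
      (connecting k K F x).comp (galRestrict IsSepClosed.lift).toAdditive := by
  obtain ⟨c, rfl⟩ := QuotientAddGroup.mk'_surjective _ x
  have := isScalarTower_sepClosure k F F'
  exact AddMonoidHom.ext fun σ => mean_map _ _

/-- The group `T̂^K` is the permutation module on the embeddings of `K`. -/
theorem exists_eq_sub_smul_of_finite_range
    {c : Gal(SeparableClosure F/F) → Character (weilTorus k K) (SeparableClosure F)}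
    (hc : ∀ σ τ, c (σ * τ) = c σ + σ • c τ) (hfin : (Set.range c).Finite) :
    ∃ q, ∀ σ, c σ = σ • q - q := by
  obtain ⟨n, q, hn, hq⟩ := exists_nsmul_eq_sub_smul hc hfin
  obtain ⟨q, rfl⟩ := weilChar_surjective q
  refine ⟨weilChar (-fun x => q x / n), fun σ => ?_⟩
  obtain ⟨f, hf⟩ := weilChar_surjective (c σ)
  have hq := hq σ
  rw [← hf, smul_weilChar] at hq ⊢
  have hq : n • f = q - q ∘ _ := weilCharEquiv.injective <|
    (map_nsmul weilCharEquiv n f).trans (hq.trans (map_sub weilCharEquiv _ _).symm)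
  refine Eq.trans (congrArg weilChar (funext fun x => ?_)) (map_sub weilCharEquiv _ _)
  have hx := congrFun hq x
  simp only [Pi.smul_apply, Pi.sub_apply, Pi.neg_apply, Function.comp_apply, nsmul_eq_mul] at hx ⊢
  rw [eq_add_of_sub_eq hx.symm, Int.mul_add_ediv_left _ _ (by exact_mod_cast hn)]
  ring

theorem connecting_injective : Function.Injective (connecting k K F) := by
  rw [injective_iff_map_eq_zero]
  intro x hx
  obtain ⟨c, rfl⟩ := QuotientAddGroup.mk'_surjective _ x
  choose b hbc hb using fun σ =>
    exists_restrictHom_eq_of_mean_eq_zero (DFunLike.congr_fun hx (Additive.ofMul σ))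
  change ∀ σ, restrictHom (b σ) = c.1 σ at hbc
  have hcocycle (σ τ) : b (σ * τ) = b σ + σ • b τ :=
    eq_of_restrictHom_eq_of_weilMean_eq
      (by rw [map_add, restrictHom_smul, hbc, hbc, hbc, c.2.2])
      (by rw [map_add, weilMean_smul, hb, hb, hb, add_zero])
  have hfin : (Set.range b).Finite := by
    refine Set.Finite.of_finite_image (f := restrictHom) ?_ ?_
    · rw [← Set.range_comp, show restrictHom ∘ b = c.1 from funext hbc]
      exact c.2.1.range_finite
    · rintro _ ⟨σ, rfl⟩ _ ⟨τ, rfl⟩ h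
      exact eq_of_restrictHom_eq_of_weilMean_eq h ((hb σ).trans (hb τ).symm)
  obtain ⟨q, hq⟩ := exists_eq_sub_smul_of_finite_range hcocycle hfin
  refine (QuotientAddGroup.eq_zero_iff c).2 ⟨restrictHom q, fun σ => ?_⟩
  change c.1 σ = _
  rw [← hbc, hq, map_sub, restrictHom_smul]

theorem connecting_eq_zero_of_forall_smul_eq (x : GalH1 k K F)
    {N : Subgroup Gal(SeparableClosure F/F)}
    (hN : ∀ σ ∈ N, ∀ χ : CharGroup k K F, σ • χ = χ) {σ : Gal(SeparableClosure F/F)}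
    (hσ : σ ∈ N) : connecting k K F x (.ofMul σ) = 0 := by
  obtain ⟨c, rfl⟩ := QuotientAddGroup.mk'_surjective _ x
  let f : Additive N →+ CharGroup k K F := AddMonoidHom.mk' (fun τ => c.1 τ.toMul) fun τ υ => by
    rw [toMul_add, Subgroup.coe_mul, c.2.2, hN τ.toMul.1 τ.toMul.2]
  have hf : f = 0 := eq_zero_of_finite_range
    (c.2.1.range_finite.subset (Set.range_subset_iff.2 fun τ => ⟨_, rfl⟩))
  have hc : c.1 σ = 0 := DFunLike.congr_fun hf (Additive.ofMul ⟨σ, hσ⟩)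
  change mean (c.1 σ) = 0
  rw [hc, map_zero]

theorem correspondsTo_iff_connecting_eq {K : IntermediateField k (SeparableClosure k)}
    [FiniteDimensional k K] [Normal k K] (x : GalH1 k K k)
    (χ : Additive Gal(K/k) →+ AddCircle (1 : ℚ)) :
    CorrespondsTo K x χ ↔
      connecting k K k x = χ.comp (AlgEquiv.restrictNormalHom K).toAdditive := by
  constructor
  · rintro ⟨c, b, ψ, z, rfl, hb, hψ, hbc, hψχ, hbz, hψz⟩
    have weilMean_b (σ τ) : weilMean (b σ) + weilMean (b τ) - weilMean (b (σ * τ)) = z σ τ := by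
      have h := congrArg weilMean (hbz σ τ)
      rwa [map_sub, map_add, weilMean_smul, map_zsmul, weilMean_normCharacter, zsmul_one] at h
    let D : Additive Gal(SeparableClosure k/k) →+ ℚ := AddMonoidHom.mk'
      (fun σ => ψ σ.toMul - weilMean (b σ.toMul)) fun σ τ => by
        rw [toMul_add]
        linarith [weilMean_b σ.toMul τ.toMul, hψz σ.toMul τ.toMul]
    have hD : D = 0 := eq_zero_of_finite_range (hψ.sub (hb.comp weilMean)).range_finite
    refine AddMonoidHom.ext fun σ => ?_
    have hψb : ψ σ.toMul = weilMean (b σ.toMul) := sub_eq_zero.1 (DFunLike.congr_fun hD σ)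
    change mean (c.1 σ.toMul) = χ _
    rw [← hbc]
    exact (mean_restrictHom _).trans ((congrArg _ hψb.symm).trans (hψχ _))
  · intro hx
    obtain ⟨c, rfl⟩ := QuotientAddGroup.mk'_surjective _ x
    choose s hs using restrictHom_surjective (k := k) (K := K) (Ω := SeparableClosure k)
    have exists_z (σ τ) : ∃ n : ℤ, s (c.1 σ) + σ • s (c.1 τ) - s (c.1 (σ * τ)) =
        n • Character.normCharacter k K (SeparableClosure k) := by
      rw [← restrictHom_eq_zero_iff, map_sub, map_add, restrictHom_smul, hs, hs, hs, c.2.2,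
        sub_self]
    choose z hz using exists_z
    refine ⟨c, fun σ => s (c.1 σ), fun σ => weilMean (s (c.1 σ)), z, rfl, c.2.1.comp s,
      c.2.1.comp fun χ => weilMean (s χ), fun σ => hs _, fun σ => ?_, hz, fun σ τ => ?_⟩
    · rw [← mean_restrictHom, hs]
      exact DFunLike.congr_fun hx (Additive.ofMul σ)
    · have h := congrArg weilMean (hz σ τ)
      rwa [map_sub, map_add, weilMean_smul, map_zsmul, weilMean_normCharacter, zsmul_one] at h

end Connecting

/-! ### `H¹(F, T̂)` and the characters of `Gal(K₀/k)` -/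

theorem exists_eq_comp_algEquiv {k K Ω : Type*} [Field k] [Field K] [Algebra k K] [Normal k K]
    [Field Ω] [Algebra k Ω] (x y : K →ₐ[k] Ω) : ∃ g : Gal(K/k), x.comp g = y := by
  let := x.toRingHom.toAlgebra
  have : IsScalarTower k K Ω := .of_algebraMap_eq fun a => (x.commutes a).symm
  exact ⟨Normal.algHomEquivAut k Ω K y, (Normal.algHomEquivAut k Ω K).symm_apply_apply y⟩

/-- Any lift `t` of `χ` to `ℚ` satisfies `∑ g, (t a + t (a⁻¹ * g) - t g) = |G| * t a`. -/
theorem exists_int_cochain {G : Type*} [Group G] [Fintype G]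
    (χ : Additive G →+ AddCircle (1 : ℚ)) :
    ∃ n : G → G → ℤ, (∀ a b, ∃ z, ∀ g, n a g + n b (a⁻¹ * g) - n (a * b) g = z) ∧
      ∀ a, (((∑ g, (n a g : ℚ)) / Fintype.card G : ℚ) : AddCircle (1 : ℚ)) = χ (.ofMul a) := by
  choose t ht using fun a : G => QuotientAddGroup.mk_surjective (χ (.ofMul a))
  have exists_n (a g : G) : ∃ n : ℤ, (n : ℚ) = t a + t (a⁻¹ * g) - t g := by
    rw [← coe_addCircle_one_eq_zero_iff]
    change (t a : AddCircle (1 : ℚ)) + (t (a⁻¹ * g) : AddCircle (1 : ℚ)) - t g = 0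
    rw [ht, ht, ht, ← map_add, ← map_sub, ← ofMul_mul, mul_inv_cancel_left, sub_self, map_zero]
  choose n hn using exists_n
  refine ⟨n, fun a b => ⟨n a 1 + n b (a⁻¹ * 1) - n (a * b) 1, fun g => ?_⟩, fun a => ?_⟩
  · have key (g : G) : (n a g + n b (a⁻¹ * g) - n (a * b) g : ℚ) = t a + t b - t (a * b) := by
      simp only [hn, mul_inv_rev, mul_assoc]
      ring
    exact_mod_cast (key g).trans (key 1).symm
  · have hsum : ∑ g, t (a⁻¹ * g) = ∑ g, t g := Equiv.sum_comp (Equiv.mulLeft a⁻¹) t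
    have hcard : (Fintype.card G : ℚ) ≠ 0 := Nat.cast_ne_zero.2 Fintype.card_ne_zero
    simp only [hn, Finset.sum_sub_distrib, Finset.sum_add_distrib, hsum, add_sub_cancel_right,
      Finset.sum_const, Finset.card_univ, nsmul_eq_mul, mul_div_cancel_left₀ _ hcard]
    exact ht a

theorem isSeparable_of_adjoin_range_eq_top {k F K E : Type*} [Field k] [Field F]
    [Field K] [Field E] [Algebra k F] [Algebra k K] [Algebra.IsSeparable k K] [Algebra F E]
    [Algebra k E] [IsScalarTower k F E] {y : K →ₐ[k] E}
    (hy : IntermediateField.adjoin F (Set.range y) = ⊤) : Algebra.IsSeparable F E := by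
  have h : Algebra.IsSeparable F (⊤ : IntermediateField F E) := by
    rw [← hy, IntermediateField.isSeparable_adjoin_iff_isSeparable]
    rintro _ ⟨a, rfl⟩
    exact ((Algebra.IsSeparable.isSeparable k a).map y y.injective).tower_top F
  exact AlgEquiv.Algebra.isSeparable IntermediateField.topEquiv

section Embeddings

variable {k : Type u} [Field k] (K₀ : IntermediateField k (SeparableClosure k))
  [Normal k K₀] (F : Type u) [Field F] [Algebra k F]

/-- An embedding of `K₀` into the separable closure of an extension of `k`. -/
def baseEmb : K₀ →ₐ[k] SeparableClosure F :=
  (IsSepClosed.lift : SeparableClosure k →ₐ[k] SeparableClosure F).comp K₀.val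

/-- The restriction homomorphism `Γ_F → Gal(K₀/k)`. -/
def galHom : Gal(SeparableClosure F/F) →* Gal(K₀/k) :=
  (AlgEquiv.restrictNormalHom K₀).comp (galRestrict IsSepClosed.lift)

theorem apply_baseEmb (σ : Gal(SeparableClosure F/F)) (a : K₀) :
    σ (baseEmb K₀ F a) = baseEmb K₀ F (galHom K₀ F σ a) :=
  (galRestrict_commutes _ σ _).symm.trans <| congrArg IsSepClosed.lift
    (AlgEquiv.restrictNormal_commutes (galRestrict IsSepClosed.lift σ) K₀ a).symm

theorem isLocallyConstant_galHom [FiniteDimensional k K₀] : IsLocallyConstant (galHom K₀ F) :=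
  IsLocallyConstant.comp_continuous (f := galRestrict IsSepClosed.lift)
    (g := AlgEquiv.restrictNormalHom K₀)
    ((IsLocallyConstant.iff_continuous _).2 (InfiniteGalois.restrictNormalHom_continuous K₀))
    (galRestrict_continuous _)

/-- The bijection `g ↦ x₀ ∘ g` between `Gal(K₀/k)` and the embeddings of `K₀` into `F_s`, where
`x₀` is the embedding `baseEmb`. -/
def embOfGal : Gal(K₀/k) ≃ (K₀ →ₐ[k] SeparableClosure F) :=
  .ofBijective (fun g => (baseEmb K₀ F).comp g)
    ⟨fun _ _ h => AlgEquiv.ext fun a => (baseEmb K₀ F).injective (DFunLike.congr_fun h a),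
      exists_eq_comp_algEquiv _⟩

variable {F} in
theorem smul_weilChar_embOfGal [FiniteDimensional k K₀] [Algebra.IsSeparable k K₀]
    (σ : Gal(SeparableClosure F/F)) (n : Gal(K₀/k) → ℤ) :
    σ • weilChar (n ∘ (embOfGal K₀ F).symm) =
      weilChar ((fun g => n ((galHom K₀ F σ)⁻¹ * g)) ∘ (embOfGal K₀ F).symm) := by
  rw [smul_weilChar]
  refine congrArg weilChar (funext fun x => congrArg n ?_)
  rw [Equiv.symm_apply_eq, Equiv.symm_apply_eq]
  refine AlgHom.ext fun a => Eq.trans ?_ (apply_baseEmb K₀ F σ _).symm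
  conv_lhs => rw [← (embOfGal K₀ F).apply_symm_apply x]
  exact congrArg (baseEmb K₀ F) (DFunLike.congr_fun
    (mul_inv_cancel_left (galHom K₀ F σ) ((embOfGal K₀ F).symm x)) a).symm

theorem smul_eq_of_mem_ker_galHom [FiniteDimensional k K₀] [Algebra.IsSeparable k K₀]
    {σ : Gal(SeparableClosure F/F)} (hσ : σ ∈ (galHom K₀ F).ker) (χ : CharGroup k K₀ F) :
    σ • χ = χ := by
  obtain ⟨χ, rfl⟩ := restrictHom_surjective χ
  obtain ⟨f, rfl⟩ := weilChar_surjective χ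
  obtain ⟨n, rfl⟩ : ∃ n, n ∘ (embOfGal K₀ F).symm = f := ⟨f ∘ embOfGal K₀ F, by ext; simp⟩
  rw [← restrictHom_smul, smul_weilChar_embOfGal, hσ]
  simp

theorem exists_connecting_eq [FiniteDimensional k K₀] [Algebra.IsSeparable k K₀]
    (χ : Additive Gal(K₀/k) →+ AddCircle (1 : ℚ)) :
    ∃ x : GalH1 k K₀ F, connecting k K₀ F x = χ.comp (galHom K₀ F).toAdditive := by
  obtain ⟨n, hn, hχ⟩ := exists_int_cochain χ
  let W (a : Gal(K₀/k)) : Character (weilTorus k K₀) (SeparableClosure F) :=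
    weilChar (n a ∘ (embOfGal K₀ F).symm)
  have weilMean_W (a : Gal(K₀/k)) :
      weilMean (W a) = (∑ g, (n a g : ℚ)) / Fintype.card Gal(K₀/k) := by
    have : IsGalois k K₀ := ⟨⟩
    rw [weilMean_weilChar, ← IsGalois.card_aut_eq_finrank, Nat.card_eq_fintype_card]
    exact congrArg (· / _) ((embOfGal K₀ F).symm.sum_comp fun g => (n a g : ℚ))
  have restrictHom_W (σ τ : Gal(SeparableClosure F/F)) :
      restrictHom (W (galHom K₀ F (σ * τ))) =
        restrictHom (W (galHom K₀ F σ)) + σ • restrictHom (W (galHom K₀ F τ)) := by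
    obtain ⟨z, hz⟩ := hn (galHom K₀ F σ) (galHom K₀ F τ)
    rw [eq_comm, ← sub_eq_zero, ← restrictHom_smul, ← map_add, ← map_sub, restrictHom_eq_zero_iff,
      smul_weilChar_embOfGal, map_mul]
    refine ⟨z, ?_⟩
    simp only [W, ← weilCharEquiv_one]
    change weilCharEquiv _ + weilCharEquiv _ - weilCharEquiv _ = _
    rw [← map_add, ← map_sub, ← map_zsmul]
    exact congrArg _ (funext fun x => by simpa using hz _)
  refine ⟨H1.mk ⟨fun σ => restrictHom (W (galHom K₀ F σ)),
    (isLocallyConstant_galHom K₀ F).comp fun a => restrictHom (W a), restrictHom_W⟩,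
    AddMonoidHom.ext fun σ => ?_⟩
  exact (mean_restrictHom _).trans ((congrArg _ (weilMean_W _)).trans (hχ _))

/-- The class in `H¹(F, T̂)` attached to a character of `Gal(K₀/k)`. -/
def charClass [FiniteDimensional k K₀] [Algebra.IsSeparable k K₀] :
    (Additive Gal(K₀/k) →+ AddCircle (1 : ℚ)) →+ GalH1 k K₀ F :=
  AddMonoidHom.mk' (fun χ => (exists_connecting_eq K₀ F χ).choose) fun χ χ' => by
    refine connecting_injective ?_
    rw [map_add, (exists_connecting_eq K₀ F _).choose_spec,
      (exists_connecting_eq K₀ F _).choose_spec, (exists_connecting_eq K₀ F _).choose_spec]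
    rfl

theorem connecting_charClass [FiniteDimensional k K₀] [Algebra.IsSeparable k K₀]
    (χ : Additive Gal(K₀/k) →+ AddCircle (1 : ℚ)) :
    connecting k K₀ F (charClass K₀ F χ) = χ.comp (galHom K₀ F).toAdditive :=
  (exists_connecting_eq K₀ F χ).choose_spec

theorem charClass_eq_zero_iff [FiniteDimensional k K₀] [Algebra.IsSeparable k K₀]
    (χ : Additive Gal(K₀/k) →+ AddCircle (1 : ℚ)) :
    charClass K₀ F χ = 0 ↔ ∀ g ∈ (galHom K₀ F).range, χ (.ofMul g) = 0 := by
  rw [← map_eq_zero_iff _ (connecting_injective (k := k) (K := K₀) (F := F)),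
    connecting_charClass]
  constructor
  · rintro h _ ⟨σ, rfl⟩
    exact DFunLike.congr_fun h (Additive.ofMul σ)
  · exact fun h => AddMonoidHom.ext fun σ => h _ ⟨σ.toMul, rfl⟩

section Abelian

variable [IsMulCommutative Gal(K₀/k)]

variable {K₀ F} in
theorem apply_eq_galHom_apply (x : K₀ →ₐ[k] SeparableClosure F)
    (σ : Gal(SeparableClosure F/F)) (a : K₀) : σ (x a) = x (galHom K₀ F σ a) := by
  obtain ⟨g, rfl⟩ := exists_eq_comp_algEquiv (baseEmb K₀ F) x
  exact (apply_baseEmb K₀ F σ _).trans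
    (congrArg _ (DFunLike.congr_fun (mul_comm' (galHom K₀ F σ) g) a))

variable {K₀ F} in
theorem galHom_eq_of_forall (x : K₀ →ₐ[k] SeparableClosure F)
    {σ : Gal(SeparableClosure F/F)} {g : Gal(K₀/k)} (h : ∀ a, σ (x a) = x (g a)) :
    galHom K₀ F σ = g :=
  AlgEquiv.ext fun a => x.injective ((apply_eq_galHom_apply x σ a).symm.trans (h a))

theorem galHom_self : galHom K₀ k = AlgEquiv.restrictNormalHom K₀ :=
  MonoidHom.ext fun σ => galHom_eq_of_forall K₀.val fun a =>
    (AlgEquiv.restrictNormal_commutes σ K₀ a).symm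

theorem galHom_galRestrict {F' : Type u} [Field F'] [Algebra k F'] [Algebra F F']
    [IsScalarTower k F F'] (j : SeparableClosure F →ₐ[F] SeparableClosure F')
    (σ : Gal(SeparableClosure F'/F')) : galHom K₀ F (galRestrict j σ) = galHom K₀ F' σ := by
  have := isScalarTower_sepClosure k F F'
  refine (galHom_eq_of_forall ((j.restrictScalars k).comp (baseEmb K₀ F)) fun a => ?_).symm
  exact (galRestrict_commutes j σ _).symm.trans (congrArg j (apply_baseEmb K₀ F _ a))

variable {K₀ F} in
theorem ker_galHom_eq_fixingSubgroup (x : K₀ →ₐ[k] SeparableClosure F) :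
    (galHom K₀ F).ker = (IntermediateField.adjoin F (Set.range x)).fixingSubgroup := by
  refine le_antisymm ?_ fun σ hσ => galHom_eq_of_forall x fun a => ?_
  · rw [← IntermediateField.le_iff_le, IntermediateField.adjoin_le_iff]
    rintro _ ⟨a, rfl⟩ ⟨σ, hσ⟩
    change σ (x a) = x a
    rw [apply_eq_galHom_apply, MonoidHom.mem_ker.1 hσ, AlgEquiv.one_apply]
  · exact (IntermediateField.mem_fixingSubgroup_iff _ _).1 hσ _
      (IntermediateField.subset_adjoin _ _ ⟨a, rfl⟩)

variable {K₀ F} in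
theorem finrank_eq_card_range_galHom [Algebra.IsSeparable k K₀] {E : Type u} [Field E]
    [Algebra F E] [Algebra k E] [IsScalarTower k F E] {y : K₀ →ₐ[k] E}
    (hy : IntermediateField.adjoin F (Set.range y) = ⊤) :
    Module.finrank F E = Nat.card (galHom K₀ F).range := by
  have := isSeparable_of_adjoin_range_eq_top hy
  let j : E →ₐ[F] SeparableClosure F := IsSepClosed.lift
  have hj : j.fieldRange =
      IntermediateField.adjoin F (Set.range ((j.restrictScalars k).comp y)) := by
    rw [AlgHom.fieldRange_eq_map, ← hy, IntermediateField.adjoin_map, ← Set.range_comp]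
    rfl
  calc Module.finrank F E
    _ = Module.finrank F j.fieldRange :=
      (AlgEquiv.ofInjectiveField j).toLinearEquiv.finrank_eq
    _ = (galHom K₀ F).ker.index := by
      rw [IntermediateField.finrank_eq_fixingSubgroup_index, hj, ker_galHom_eq_fixingSubgroup]
    _ = _ := Subgroup.index_ker _

variable [FiniteDimensional k K₀] [Algebra.IsSeparable k K₀]

theorem charClass_surjective : Function.Surjective (charClass K₀ F) := by
  intro x
  let : CommGroup Gal(K₀/k) := { (inferInstance : Group Gal(K₀/k)) with mul_comm := mul_comm' }
  let ρ := galHom K₀ F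
  let χ : Additive ρ.range →+ AddCircle (1 : ℚ) :=
    ρ.rangeRestrict.toAdditive.liftOfSurjective ρ.rangeRestrict_surjective
      ⟨connecting k K₀ F x, fun σ hσ => connecting_eq_zero_of_forall_smul_eq x
        (fun _ => smul_eq_of_mem_ker_galHom K₀ F) (σ := σ.toMul) (ρ.ker_rangeRestrict ▸ hσ)⟩
  obtain ⟨χ', hχ'⟩ : ∃ χ' : Additive Gal(K₀/k) →+ AddCircle (1 : ℚ),
      χ'.comp ρ.range.subtype.toAdditive = χ :=
    CharacterModule.dual_surjective_of_injective ρ.range.subtype.toAdditive.toIntLinearMap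
      (fun _ _ h => Subtype.ext h) χ
  refine ⟨χ', connecting_injective ?_⟩
  rw [connecting_charClass]
  exact AddMonoidHom.ext fun σ =>
    (DFunLike.congr_fun hχ' (ρ.rangeRestrict.toAdditive σ)).trans
      (AddMonoidHom.liftOfRightInverse_comp_apply _ _ _ _ σ)

theorem baseChange_charClass {F' : Type u} [Field F'] [Algebra k F'] [Algebra F F']
    [IsScalarTower k F F'] (χ : Additive Gal(K₀/k) →+ AddCircle (1 : ℚ)) :
    baseChange K₀ F F' (charClass K₀ F χ) = charClass K₀ F' χ := by
  refine connecting_injective ?_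
  rw [connecting_baseChange, connecting_charClass, connecting_charClass]
  exact AddMonoidHom.ext fun σ => congrArg (fun g => χ (.ofMul g)) (galHom_galRestrict K₀ F _ _)

theorem charClass_self_injective : Function.Injective (charClass K₀ k) := by
  rw [injective_iff_map_eq_zero]
  intro χ h
  rw [charClass_eq_zero_iff, galHom_self, MonoidHom.range_eq_top.2
    (AlgEquiv.restrictNormalHom_surjective (SeparableClosure k))] at h
  exact AddMonoidHom.ext fun g => h g.toMul trivial

theorem correspondsTo_iff_eq_charClass (x : GalH1 k K₀ k)
    (χ : Additive Gal(K₀/k) →+ AddCircle (1 : ℚ)) :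
    CorrespondsTo K₀ x χ ↔ x = charClass K₀ k χ := by
  rw [correspondsTo_iff_connecting_eq, ← galHom_self, ← connecting_charClass,
    connecting_injective.eq_iff]

end Abelian

end Embeddings

/-! ### Extension of absolute values -/

theorem le_of_forall_pow_le {u D M : ℝ} (hD : 0 ≤ D)
    (h : ∀ n : ℕ, u ^ n ≤ M * (n + 1) * D ^ n) : u ≤ D := by
  by_contra! hlt
  rcases hD.eq_or_lt with rfl | hD
  · exact absurd (h 1) (by simpa using hlt)
  have hr : 1 < u / D := (one_lt_div hD).2 hlt
  have hlim : Filter.Tendsto (fun n : ℕ => M * (n ^ 1 / (u / D) ^ n + n ^ 0 / (u / D) ^ n))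
      Filter.atTop (nhds 0) := by
    simpa using ((tendsto_pow_const_div_const_pow_of_one_lt 1 hr).add
      (tendsto_pow_const_div_const_pow_of_one_lt 0 hr)).const_mul M
  obtain ⟨n, hn⟩ := (hlim.eventually (gt_mem_nhds one_pos)).exists
  refine absurd (h n) (not_le.2 ?_)
  rwa [pow_one, pow_zero, ← add_div, ← mul_div_assoc, div_lt_one (pow_pos (one_pos.trans hr) n),
    div_pow, lt_div_iff₀ (pow_pos hD n)] at hn

section AbsRpow

variable {R : Type*} [Semiring R] (v : AbsoluteValue R ℝ) {c : ℝ}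

/-- The power `v ^ c` of an absolute value, for exponents `c` for which it satisfies the triangle
inequality. -/
def absRpow (hc : c ≠ 0) (hadd : ∀ x y, v (x + y) ^ c ≤ v x ^ c + v y ^ c) :
    AbsoluteValue R ℝ where
  toFun x := v x ^ c
  map_mul' x y := by rw [map_mul, Real.mul_rpow (v.nonneg _) (v.nonneg _)]
  nonneg' x := Real.rpow_nonneg (v.nonneg _) _
  eq_zero' x := (Real.rpow_eq_zero (v.nonneg _) hc).trans v.eq_zero
  add_le' := hadd

theorem add_rpow_le_of_le_one (hc : 0 ≤ c) (hc1 : c ≤ 1) (x y : R) :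
    v (x + y) ^ c ≤ v x ^ c + v y ^ c :=
  (Real.rpow_le_rpow (v.nonneg _) (v.add_le x y) hc).trans
    (Real.rpow_add_le_add_rpow (v.nonneg x) (v.nonneg y) hc hc1)

end AbsRpow

/-- The triangle inequality for `v ^ c` follows from the one for `v` applied to the binomial
expansion of `(x + y) ^ n`: as `v ^ c` is the usual absolute value on `ℕ`, each of the `n + 1` terms
is at most `((v x ^ c + v y ^ c) ^ n) ^ c⁻¹`. -/
theorem add_rpow_le_of_natCast {R : Type*} [CommSemiring R] [Nontrivial R]
    (v : AbsoluteValue R ℝ) {c : ℝ} (hc : 0 < c) (hv : ∀ n : ℕ, v n ^ c = n) (x y : R) :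
    v (x + y) ^ c ≤ v x ^ c + v y ^ c := by
  set A := v x ^ c
  set B := v y ^ c
  have hA0 : 0 ≤ A := Real.rpow_nonneg (v.nonneg _) _
  have hB0 : 0 ≤ B := Real.rpow_nonneg (v.nonneg _) _
  have term_rpow (m n : ℕ) :
      v (x ^ m * y ^ (n - m) * n.choose m) ^ c = A ^ m * B ^ (n - m) * n.choose m := by
    rw [map_mul, map_mul, map_pow, map_pow, Real.mul_rpow (by positivity) (v.nonneg _),
      Real.mul_rpow (by positivity) (by positivity), hv, ← Real.rpow_pow_comm (v.nonneg _),
      ← Real.rpow_pow_comm (v.nonneg _)]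
  have term_le (n : ℕ) : ∀ m ∈ Finset.range (n + 1),
      v (x ^ m * y ^ (n - m) * n.choose m) ≤ ((A + B) ^ c⁻¹) ^ n := by
    intro m hm
    rw [Real.rpow_pow_comm (by positivity), Real.le_rpow_inv_iff_of_pos (v.nonneg _)
      (by positivity) hc, term_rpow, add_pow]
    exact Finset.single_le_sum (f := fun m => A ^ m * B ^ (n - m) * (n.choose m : ℝ))
      (fun i _ => by positivity) hm
  rw [← Real.le_rpow_inv_iff_of_pos (v.nonneg _) (by positivity) hc]
  refine le_of_forall_pow_le (M := 1) (by positivity) fun n => ?_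
  calc v (x + y) ^ n
    _ = v ((x + y) ^ n) := (map_pow v _ _).symm
    _ ≤ ∑ m ∈ Finset.range (n + 1), v (x ^ m * y ^ (n - m) * n.choose m) :=
      add_pow x y n ▸ v.sum_le _ _
    _ ≤ ∑ _m ∈ Finset.range (n + 1), ((A + B) ^ c⁻¹) ^ n := Finset.sum_le_sum (term_le n)
    _ = 1 * (n + 1) * ((A + B) ^ c⁻¹) ^ n := by simp

theorem norm_algHom_complex {C : Type*} [NormedField C] [NormedAlgebra ℝ C]
    [FiniteDimensional ℝ C] (τ : C →ₐ[ℝ] ℂ) (x : C) : ‖τ x‖ = ‖x‖ := by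
  let T : C →L[ℝ] ℂ := τ.toLinearMap.toContinuousLinearMap
  have hle (x : C) : ‖τ x‖ ≤ ‖x‖ := by
    refine le_of_forall_pow_le (M := ‖T‖) (norm_nonneg _) fun n => ?_
    rw [← norm_pow, ← map_pow, ← norm_pow]
    exact (T.le_opNorm (x ^ n)).trans <| mul_le_mul_of_nonneg_right
      (le_mul_of_one_le_right (norm_nonneg _) (by simp)) (norm_nonneg _)
  rcases eq_or_ne x 0 with rfl | hx
  · rw [map_zero, norm_zero, norm_zero]
  · have h := hle x⁻¹
    rw [map_inv₀, norm_inv, norm_inv, inv_le_inv₀ (by simpa using hx) (by simpa using hx)] at h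
    exact (hle x).antisymm h

theorem exists_ringHom_real_norm_eq {C : Type*} [NormedField C] [CompleteSpace C] (f : ℚ →+* C)
    (hf : ∀ q, ‖f q‖ = ‖q‖) : ∃ g : ℝ →+* C, ∀ r, ‖g r‖ = ‖r‖ := by
  have hf' : Isometry f := AddMonoidHomClass.isometry_of_norm f hf
  have hind : IsUniformInducing (Rat.castHom ℝ) := Rat.isUniformEmbedding_coe_real.isUniformInducing
  have hden : DenseRange (Rat.castHom ℝ) := Rat.denseRange_cast
  let g : ℝ →+* C := IsDenseInducing.extendRingHom hind hden hf'.uniformContinuous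
  have hg : Continuous g :=
    (uniformContinuous_uniformly_extend hind hden hf'.uniformContinuous).continuous
  refine ⟨g, fun r => hden.induction_on r (isClosed_eq (by fun_prop) (by fun_prop)) fun q => ?_⟩
  rw [show g (Rat.castHom ℝ q) = f q from (hind.isDenseInducing hden).extend_eq hf'.continuous q,
    hf]
  rfl

section Archimedean

variable {F : Type*} [Field F] (v : AbsoluteValue F ℝ)

theorem norm_algebraMap_completion (x : F) : ‖algebraMap F v.Completion x‖ = v x := by
  rw [UniformSpace.Completion.algebraMap_def, UniformSpace.Completion.norm_coe]
  rfl

/-- By the Gelfand–Mazur theorem, the completion of `F` is `ℝ` or `ℂ`. -/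
theorem exists_complex_embedding_norm_eq [CharZero F] (hv : ∀ q : ℚ, v q = |(q : ℝ)|) :
    ∃ τ : F →+* ℂ, ∀ x, ‖τ x‖ = v x := by
  let C := v.Completion
  have hrat (q : ℚ) : ‖(algebraMap F C).comp (Rat.castHom F) q‖ = ‖q‖ :=
    (norm_algebraMap_completion v q).trans (hv q)
  obtain ⟨g, hg⟩ := exists_ringHom_real_norm_eq _ hrat
  let : Algebra ℝ C := g.toAlgebra
  let : NormedAlgebra ℝ C :=
    { norm_smul_le := fun r x => by
        rw [Algebra.smul_def, norm_mul]
        exact (congrArg (· * ‖x‖) (hg r)).le }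
  obtain ⟨τ, _⟩ : ∃ _ : C →ₐ[ℝ] ℂ, FiniteDimensional ℝ C := by
    rcases NormedAlgebra.Real.nonempty_algEquiv_or C with ⟨⟨e⟩⟩ | ⟨⟨e⟩⟩
    · exact ⟨(Algebra.ofId ℝ ℂ).comp e.toAlgHom, e.symm.toLinearEquiv.finiteDimensional⟩
    · exact ⟨e.toAlgHom, e.symm.toLinearEquiv.finiteDimensional⟩
  exact ⟨τ.toRingHom.comp (algebraMap F C), fun x =>
    (norm_algHom_complex τ _).trans (norm_algebraMap_completion v x)⟩

variable {v}

theorem charZero_of_one_lt_natCast {m : ℕ} (hm : 1 < v m) : CharZero F := by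
  obtain ⟨p, hp⟩ := CharP.exists F
  rcases CharP.char_is_prime_or_zero F p with hpp | rfl
  · have : Fact p.Prime := ⟨hpp⟩
    have frob : v m ^ p = v m := by rw [← map_pow, ← frobenius_def, map_natCast]
    exact absurd frob (lt_self_pow₀ hm hpp.one_lt).ne'
  · exact CharP.charP_to_charZero F

theorem exists_ratCast_rpow_eq_abs [CharZero F] {m : ℕ} (hm : 1 < v m) :
    ∃ c : ℝ, 1 ≤ c ∧ ∀ q : ℚ, v q ^ c = |(q : ℝ)| := by
  let f : AbsoluteValue ℚ ℝ := v.comp (Rat.castHom F).injective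
  have hf : ¬ ∀ n : ℕ, f n ≤ 1 := fun h =>
    not_le.2 hm ((congrArg v (Rat.cast_natCast m)).symm.trans_le (h m))
  obtain ⟨c, hc, hfc⟩ := AbsoluteValue.isEquiv_iff_exists_rpow_eq.1
    (Rat.AbsoluteValue.equiv_real_of_unbounded hf)
  have hvq (q : ℚ) : v q ^ c = |(q : ℝ)| := by
    rw [← Rat.cast_abs, ← Rat.AbsoluteValue.real_eq_abs]
    exact congrFun hfc q
  refine ⟨c, ?_, hvq⟩
  have two_le : v ((2 : ℚ) : F) ≤ 2 := by
    have h := v.add_le 1 1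
    rw [map_one, one_add_one_eq_two, one_add_one_eq_two] at h
    exact_mod_cast h
  have h := Real.rpow_le_rpow (v.nonneg _) two_le hc.le
  rw [hvq, Rat.cast_ofNat, abs_two] at h
  exact (Real.rpow_le_rpow_left_iff one_lt_two).1 ((Real.rpow_one 2).trans_le h)

end Archimedean

section Places

variable {F L : Type u} [Field F] [Field L] [Algebra F L] {v : AbsoluteValue F ℝ}

/-- Up to a power, an archimedean absolute value comes from an embedding into `ℂ`. -/
theorem nonempty_placeOver_of_archimedean [Algebra.IsAlgebraic F L] {m : ℕ} (hm : 1 < v m) :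
    Nonempty (PlaceOver v L) := by
  have := charZero_of_one_lt_natCast hm
  obtain ⟨c, hc1, hvc⟩ := exists_ratCast_rpow_eq_abs hm
  have hc : 0 < c := one_pos.trans_le hc1
  have hadd := add_rpow_le_of_natCast v hc fun n => by simpa using hvc n
  obtain ⟨τ, hτ⟩ := exists_complex_embedding_norm_eq (absRpow v hc.ne' hadd) hvc
  let := τ.toAlgebra
  let j : L →ₐ[F] ℂ := IsAlgClosed.lift
  let w := (NormedField.toAbsoluteValue ℂ).comp j.injective
  refine ⟨⟨absRpow w (inv_ne_zero hc.ne')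
    (add_rpow_le_of_le_one w (inv_nonneg.2 hc.le) (inv_le_one_of_one_le₀ hc1)), ⟨?_⟩⟩⟩
  ext x
  calc ‖j (algebraMap F L x)‖ ^ c⁻¹
    _ = ‖τ x‖ ^ c⁻¹ := by rw [j.commutes]; rfl
    _ = (v x ^ c) ^ c⁻¹ := congrArg (· ^ c⁻¹) (hτ x)
    _ = v x := Real.rpow_rpow_inv (v.nonneg _) hc.ne'

/-- The completion at a nontrivial absolute value, as a nontrivially normed field. -/
@[reducible]
def completionNontriviallyNormedField (hv : v.IsNontrivial) :
    NontriviallyNormedField v.Completion :=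
  { (inferInstance : NormedField v.Completion) with
    non_trivial := by
      obtain ⟨x, hx⟩ := hv.exists_abv_gt_one
      exact ⟨algebraMap F v.Completion x, by rwa [norm_algebraMap_completion]⟩ }

theorem nonempty_placeOver_of_nonarchimedean [Algebra.IsAlgebraic F L]
    (hv : v.IsNontrivial) (h : ∀ m : ℕ, v m ≤ 1) : Nonempty (PlaceOver v L) := by
  let := completionNontriviallyNormedField hv
  have : IsUltrametricDist v.Completion :=
    IsUltrametricDist.isUltrametricDist_of_forall_norm_natCast_le_one fun n => by
      rw [← map_natCast (algebraMap F v.Completion), norm_algebraMap_completion]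
      exact h n
  let j : L →ₐ[F] AlgebraicClosure v.Completion := IsAlgClosed.lift
  let N := spectralMulAlgNorm v.Completion (AlgebraicClosure v.Completion)
  refine ⟨⟨(MulRingNorm.mulRingNormEquivAbsoluteValue N.toMulRingNorm).comp j.injective, ⟨?_⟩⟩⟩
  ext x
  calc N (j (algebraMap F L x))
    _ = spectralNorm v.Completion (AlgebraicClosure v.Completion)
        (algebraMap v.Completion _ (algebraMap F v.Completion x)) := by
      rw [j.commutes, IsScalarTower.algebraMap_apply F v.Completion]
      rfl
    _ = v x := (spectralNorm_extends _).trans (norm_algebraMap_completion v x)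

theorem nonempty_placeOver [Algebra.IsAlgebraic F L] (hv : v.IsNontrivial) :
    Nonempty (PlaceOver v L) := by
  by_cases h : ∀ m : ℕ, v m ≤ 1
  · exact nonempty_placeOver_of_nonarchimedean hv h
  · push Not at h
    exact nonempty_placeOver_of_archimedean h.choose_spec

theorem PlaceOver.isNontrivial (hv : v.IsNontrivial) (w : PlaceOver v L) :
    w.abs.IsNontrivial := by
  obtain ⟨x, hx, hx'⟩ := hv
  exact ⟨algebraMap F L x, by simpa using hx,
    (DFunLike.congr_fun w.liesOver.comp_eq x).trans_ne hx'⟩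

/-! ### Local degrees -/

theorem PlaceOver.span_range_algebraMap_eq_top [FiniteDimensional F L] (hv : v.IsNontrivial)
    (w : PlaceOver v L) :
    Submodule.span v.Completion (Set.range (algebraMap L w.abs.Completion)) = ⊤ := by
  let := completionNontriviallyNormedField hv
  have : ContinuousSMul v.Completion w.abs.Completion :=
    continuousSMul_of_algebraMap _ _ UniformSpace.Completion.continuous_map
  let i := (IsScalarTower.toAlgHom F L w.abs.Completion).toLinearMap
  let b := Module.finBasis F L
  let V := Submodule.span v.Completion (Set.range (i ∘ b))
  have mem_V (l : L) : i l ∈ V := by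
    rw [← b.sum_repr l, map_sum]
    refine V.sum_mem fun n _ => ?_
    rw [map_smul, ← algebraMap_smul v.Completion]
    exact V.smul_mem _ (Submodule.subset_span ⟨n, rfl⟩)
  have : FiniteDimensional v.Completion V := FiniteDimensional.span_of_finite _ (Set.finite_range _)
  have isClosed_V : IsClosed (V : Set w.abs.Completion) := Submodule.closed_of_finiteDimensional V
  refine eq_top_iff.2 fun x _ => Submodule.span_mono (Set.range_comp_subset_range b i) ?_
  refine UniformSpace.Completion.induction_on x isClosed_V fun a => ?_
  have h := mem_V a.ofAbs
  rwa [show i a.ofAbs = _ from UniformSpace.Completion.algebraMap_def ..] at h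

theorem PlaceOver.adjoin_image_algebraMap_eq_top [FiniteDimensional F L] (hv : v.IsNontrivial)
    (w : PlaceOver v L) {S : Set L} (hS : IntermediateField.adjoin F S = ⊤) :
    IntermediateField.adjoin v.Completion (algebraMap L w.abs.Completion '' S) = ⊤ := by
  set D := IntermediateField.adjoin v.Completion (algebraMap L w.abs.Completion '' S)
  have adjoin_le : IntermediateField.adjoin F S ≤
      (D.restrictScalars F).comap (IsScalarTower.toAlgHom F L w.abs.Completion) :=
    IntermediateField.adjoin_le_iff.2 fun s hs =>
      IntermediateField.subset_adjoin _ _ ⟨s, hs, rfl⟩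
  have span_le : Submodule.span v.Completion (Set.range (algebraMap L w.abs.Completion)) ≤
      D.toSubalgebra.toSubmodule := by
    rw [Submodule.span_le]
    rintro _ ⟨l, rfl⟩
    exact adjoin_le (hS ▸ IntermediateField.mem_top)
  rw [w.span_range_algebraMap_eq_top hv] at span_le
  exact eq_top_iff.2 fun x _ => span_le trivial

variable {k : Type u} [Field k] (p : ℕ) (K₀ : IntermediateField k (SeparableClosure k))
  [Normal k K₀]

/-- The exponent of `p` in the order of the image of `Γ_F` in `Gal(K₀/k)`, that is in the degree
over `F` of the compositum of `F` and `K₀`. -/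
def fieldExp (F : Type u) [Field F] [Algebra k F] : ℕ :=
  padicValNat p (Nat.card (galHom K₀ F).range)

variable {K₀} in
theorem localExp_eq_fieldExp [FiniteDimensional k K₀] [Algebra.IsSeparable k K₀]
    [IsMulCommutative Gal(K₀/k)] [Algebra k F] [Algebra k L] [IsScalarTower k F L]
    {y : K₀ →ₐ[k] L} (hy : IntermediateField.adjoin F (Set.range y) = ⊤) (hv : v.IsNontrivial) :
    localExp p v L = fieldExp p K₀ v.Completion := by
  have : FiniteDimensional F L :=
    Module.finite_of_finrank_pos (finrank_eq_card_range_galHom hy ▸ Nat.card_pos)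
  have := nonempty_placeOver (L := L) hv
  have finrank_eq (w : PlaceOver v L) :
      Module.finrank v.Completion w.abs.Completion = Nat.card (galHom K₀ v.Completion).range := by
    have h := w.adjoin_image_algebraMap_eq_top hv hy
    rw [← Set.range_comp] at h
    exact finrank_eq_card_range_galHom
      (y := (IsScalarTower.toAlgHom k L w.abs.Completion).comp y) h
  simp only [localExp, finrank_eq, ciSup_const, fieldExp]

end Places

section Cyclic

theorem mem_iff_exists_pow_index {G : Type*} [Group G] [IsCyclic G] [Finite G]
    (H : Subgroup G) {h : G} : h ∈ H ↔ ∃ g, g ^ H.index = h := by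
  let : CommGroup G := IsCyclic.commGroup
  have range_le : (powMonoidHom H.index : G →* G).range ≤ H := by
    rintro _ ⟨g, rfl⟩
    exact H.pow_index_mem g
  have card_range : Nat.card (powMonoidHom H.index : G →* G).range = Nat.card H := by
    rw [IsCyclic.card_powMonoidHom_range, Nat.gcd_eq_right H.index_dvd_card]
    exact Nat.div_eq_of_eq_mul_left (Nat.pos_of_ne_zero H.index_ne_zero_of_finite)
      H.card_mul_index.symm
  exact SetLike.ext_iff.1 (Subgroup.eq_of_le_of_card_ge range_le card_range.ge).symm h

theorem exists_addEquiv_of_ker_eq {A B C : Type*} [AddCommGroup A] [AddCommGroup B]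
    [AddCommGroup C] {f : A →+ B} {g : A →+ C} (hf : Function.Surjective f)
    (hg : Function.Surjective g) (h : f.ker = g.ker) : ∃ Φ : B ≃+ C, ∀ a, Φ (f a) = g a := by
  let e := QuotientAddGroup.quotientKerEquivOfSurjective f hf
  refine ⟨e.symm.trans (QuotientAddGroup.liftEquiv f.ker hg h), fun a => ?_⟩
  have he : e.symm (f a) = (a : A ⧸ f.ker) := e.symm_apply_eq.2 rfl
  rw [AddEquiv.trans_apply, he]
  rfl

end Cyclic

/-! ### Congruences modulo powers of `p` -/

section Proj

variable {p s t r : ℕ}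

theorem proj_eq_castHom (h : t ≤ s) (a : ZMod (p ^ s)) :
    proj t a = ZMod.castHom (pow_dvd_pow p h) (ZMod (p ^ t)) a := rfl

theorem proj_surjective (h : t ≤ s) :
    Function.Surjective (proj t : ZMod (p ^ s) → ZMod (p ^ t)) :=
  ZMod.castHom_surjective (pow_dvd_pow p h)

theorem proj_proj (hts : t ≤ s) (hrt : r ≤ t) (a : ZMod (p ^ s)) :
    proj r (proj t a) = proj r a := by
  rw [proj_eq_castHom hrt, proj_eq_castHom hts, proj_eq_castHom (hrt.trans hts),
    ← RingHom.comp_apply, ZMod.castHom_comp]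

theorem proj_eq_proj_of_le {s' : ℕ} (hs : t ≤ s) (hs' : t ≤ s') (hrt : r ≤ t)
    {a : ZMod (p ^ s)} {b : ZMod (p ^ s')} (h : proj t a = proj t b) : proj r a = proj r b := by
  rw [← proj_proj hs hrt, h, proj_proj hs' hrt]

theorem exists_forall_proj_eq (t : ℕ) (a : ZMod (p ^ s)) :
    ∃ b : ZMod (p ^ t), ∀ r ≤ s, r ≤ t → proj r b = proj r a := by
  rcases le_total s t with hst | hts
  · obtain ⟨b, rfl⟩ := proj_surjective hst a
    exact ⟨b, fun r hrs _ => (proj_proj hst hrs b).symm⟩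
  · exact ⟨proj t a, fun r _ hrt => proj_proj hts hrt a⟩

theorem proj_eq_zero_iff_nsmul_eq_zero (hp : p ≠ 0) (h : t ≤ s) (a : ZMod (p ^ s)) :
    proj t a = 0 ↔ p ^ (s - t) • a = 0 := by
  have : NeZero (p ^ s) := ⟨pow_ne_zero _ hp⟩
  obtain ⟨m, rfl⟩ := ZMod.natCast_zmod_surjective a
  rw [proj_eq_castHom h, map_natCast, ZMod.natCast_eq_zero_iff, nsmul_eq_mul, ← Nat.cast_mul,
    ZMod.natCast_eq_zero_iff, ← pow_sub_mul_pow p h]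
  exact (Nat.mul_dvd_mul_iff_left (pow_pos hp.bot_lt _)).symm

end Proj

section Compositum

variable {k : Type u} [Field k] (K₀ K₁ : IntermediateField k (SeparableClosure k))

/-- The inclusion of `K₀` into `K₀ K₁`, the latter being encoded as an extension of `K₁`. -/
def toCompositum : K₀ →ₐ[k] compositum K₀ K₁ :=
  (IntermediateField.inclusion (le_sup_left : K₀ ≤ K₀ ⊔ K₁) :)

theorem adjoin_range_toCompositum :
    IntermediateField.adjoin K₁ (Set.range (toCompositum K₀ K₁)) = ⊤ := by
  set D := IntermediateField.adjoin K₁ (Set.range (toCompositum K₀ K₁))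
  have sup_le_lift : K₀ ⊔ K₁ ≤ (IntermediateField.lift D).restrictScalars k := by
    refine sup_le (fun x hx => ?_) fun x hx => (IntermediateField.lift D).algebraMap_mem ⟨x, hx⟩
    exact (IntermediateField.mem_lift (toCompositum K₀ K₁ ⟨x, hx⟩)).2
      (IntermediateField.subset_adjoin _ _ ⟨⟨x, hx⟩, rfl⟩)
  exact eq_top_iff.2 fun x _ => (IntermediateField.mem_lift x).1 (sup_le_lift x.2)

theorem globalExp_eq_fieldExp {p : ℕ} {K₀ : IntermediateField k (SeparableClosure k)}
    [IsGalois k K₀] [IsMulCommutative Gal(K₀/k)] {ι : Type*}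
    {K' : ι → IntermediateField k (SeparableClosure k)} (i : ι) :
    globalExp p K₀ K' i = fieldExp p K₀ (K' i) := by
  rw [globalExp, fieldExp, finrank_eq_card_range_galHom (adjoin_range_toCompositum K₀ (K' i))]

end Compositum

section Delta

variable {k : Type u} [Field k] {p : ℕ} {K₀ : IntermediateField k (SeparableClosure k)}
  {ι : Type*} [Fintype ι] {K' : ι → IntermediateField k (SeparableClosure k)}

theorem globalExp_le_maxExp (i : ι) : globalExp p K₀ K' i ≤ maxExp p K₀ K' :=
  Finset.le_sup (f := globalExp p K₀ K') (Finset.mem_univ i)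

theorem le_delta_iff {a : SumZMod p K₀ K'} {n : ZMod (p ^ maxExp p K₀ K')} {i : ι}
    {r : ℕ} (hr : r ≤ globalExp p K₀ K' i) : r ≤ delta n a i ↔ proj r n = proj r (a i) := by
  have bdd : BddAbove {r | r ≤ globalExp p K₀ K' i ∧ proj r n = proj r (a i)} :=
    ⟨_, fun r hr => hr.1⟩
  refine ⟨fun h => ?_, fun h => le_csSup bdd ⟨hr, h⟩⟩
  obtain ⟨delta_le, proj_delta⟩ :
      delta n a i ∈ {r | r ≤ globalExp p K₀ K' i ∧ proj r n = proj r (a i)} :=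
    Nat.sSup_mem ⟨0, Nat.zero_le _, (pow_zero p ▸ inferInstance : Subsingleton (ZMod (p ^ 0))).elim
      _ _⟩ bdd
  exact proj_eq_proj_of_le (delta_le.trans (globalExp_le_maxExp i)) delta_le h proj_delta

end Delta

theorem isScalarTower_completion {k F : Type u} [Field k] [Field F] [Algebra k F]
    (v : AbsoluteValue F ℝ) : IsScalarTower k F v.Completion := inferInstance

theorem Place.isNontrivial {k : Type u} [Field k] (v : Place k) : v.abs.IsNontrivial :=
  (Quotient.out v).2

/-! ### The groups `H¹(F, T̂)` as quotients of `ℤ/p^e` -/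

variable {k : Type u} [Field k] {p e : ℕ} {K₀ : IntermediateField k (SeparableClosure k)}
  [FiniteDimensional k K₀] [IsGalois k K₀]

section FieldExp

variable (F : Type u) [Field F] [Algebra k F]

theorem fieldExp_le_of_algebra [IsMulCommutative Gal(K₀/k)] (F' : Type u) [Field F']
    [Algebra k F'] [Algebra F F'] [IsScalarTower k F F'] :
    fieldExp p K₀ F' ≤ fieldExp p K₀ F := by
  have range_le : (galHom K₀ F').range ≤ (galHom K₀ F).range := by
    rintro _ ⟨σ, rfl⟩
    exact ⟨galRestrict IsSepClosed.lift σ, galHom_galRestrict ..⟩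
  rcases eq_or_ne p 1 with rfl | hp
  · simp [fieldExp]
  · exact (padicValNat_dvd_iff_le_of_ne_one hp Nat.card_pos.ne').1
      (pow_padicValNat_dvd.trans (Subgroup.card_dvd_of_le range_le))

theorem charClass_eq_zero_iff_index_nsmul [IsCyclic Gal(K₀/k)]
    (χ : Additive Gal(K₀/k) →+ AddCircle (1 : ℚ)) :
    charClass K₀ F χ = 0 ↔ (galHom K₀ F).range.index • χ = 0 := by
  rw [charClass_eq_zero_iff]
  constructor
  · intro h
    refine AddMonoidHom.ext fun g => (map_nsmul χ _ g).symm.trans ?_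
    exact h _ ((mem_iff_exists_pow_index _).2 ⟨g.toMul, rfl⟩)
  · intro h g hg
    obtain ⟨g, rfl⟩ := (mem_iff_exists_pow_index _).1 hg
    rw [ofMul_pow, map_nsmul]
    exact DFunLike.congr_fun h (.ofMul g)

variable (hp : p.Prime) (hdeg : Module.finrank k K₀ = p ^ e)
include hp hdeg

theorem card_range_galHom : Nat.card (galHom K₀ F).range = p ^ fieldExp p K₀ F := by
  have h := Subgroup.card_subgroup_dvd_card (galHom K₀ F).range
  rw [IsGalois.card_aut_eq_finrank, hdeg] at h
  obtain ⟨r, -, hr⟩ := (Nat.dvd_prime_pow hp).1 h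
  have : Fact p.Prime := ⟨hp⟩
  rw [fieldExp, hr, padicValNat.prime_pow]

theorem fieldExp_le : fieldExp p K₀ F ≤ e := by
  have h := Subgroup.card_subgroup_dvd_card (galHom K₀ F).range
  rwa [IsGalois.card_aut_eq_finrank, hdeg, card_range_galHom F hp hdeg,
    Nat.pow_dvd_pow_iff_le_right hp.one_lt] at h

theorem index_range_galHom : (galHom K₀ F).range.index = p ^ (e - fieldExp p K₀ F) := by
  have h := (galHom K₀ F).range.card_mul_index
  rw [IsGalois.card_aut_eq_finrank, hdeg, card_range_galHom F hp hdeg,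
    ← pow_mul_pow_sub p (fieldExp_le F hp hdeg)] at h
  exact Nat.eq_of_mul_eq_mul_left (pow_pos hp.pos _) h

variable [IsCyclic Gal(K₀/k)] (γ : (Additive Gal(K₀/k) →+ AddCircle (1 : ℚ)) ≃+ ZMod (p ^ e))
theorem charClass_eq_zero_iff_proj (χ : Additive Gal(K₀/k) →+ AddCircle (1 : ℚ)) :
    charClass K₀ F χ = 0 ↔ proj (fieldExp p K₀ F) (γ χ) = 0 := by
  rw [proj_eq_zero_iff_nsmul_eq_zero hp.ne_zero (fieldExp_le F hp hdeg), ← map_nsmul,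
    map_eq_zero_iff γ γ.injective, charClass_eq_zero_iff_index_nsmul,
    index_range_galHom F hp hdeg]

theorem charClass_eq_iff_proj (χ ψ : Additive Gal(K₀/k) →+ AddCircle (1 : ℚ)) :
    charClass K₀ F χ = charClass K₀ F ψ ↔
      proj (fieldExp p K₀ F) (γ χ) = proj (fieldExp p K₀ F) (γ ψ) := by
  have hle := fieldExp_le F hp hdeg
  rw [← sub_eq_zero, ← map_sub, charClass_eq_zero_iff_proj F hp hdeg γ, map_sub,
    proj_eq_castHom hle, map_sub, sub_eq_zero, proj_eq_castHom hle, proj_eq_castHom hle]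

theorem exists_addEquiv_galH1 :
    ∃ Φ : GalH1 k K₀ F ≃+ ZMod (p ^ fieldExp p K₀ F),
      ∀ χ, Φ (charClass K₀ F χ) = proj (fieldExp p K₀ F) (γ χ) := by
  let π := ZMod.castHom (pow_dvd_pow p (fieldExp_le F hp hdeg)) (ZMod (p ^ fieldExp p K₀ F))
  exact exists_addEquiv_of_ker_eq (g := π.toAddMonoidHom.comp γ.toAddMonoidHom)
    (charClass_surjective K₀ F) ((proj_surjective (fieldExp_le F hp hdeg)).comp γ.surjective)
    (AddSubgroup.ext fun χ => charClass_eq_zero_iff_proj F hp hdeg γ χ)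

end FieldExp

theorem mem_selmerGroup_charClass_iff [IsMulCommutative Gal(K₀/k)] {ι : Type*} {E : ι → Type u}
    [∀ i, Field (E i)] [∀ i, Algebra k (E i)]
    (χ : ι → Additive Gal(K₀/k) →+ AddCircle (1 : ℚ)) :
    (fun i => charClass K₀ (E i) (χ i)) ∈ selmerGroup k K₀ E ↔
      ∀ v : Place k, ∃ ψ, ∀ i (w : PlaceOver v.abs (E i)),
        charClass K₀ w.abs.Completion ψ = charClass K₀ w.abs.Completion (χ i) := by
  constructor
  · rintro ⟨y, hy⟩ v
    obtain ⟨ψ, hψ⟩ := charClass_surjective K₀ v.abs.Completion (y v)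
    refine ⟨ψ, fun i w => ?_⟩
    rw [← baseChange_charClass K₀ v.abs.Completion, hψ, ← hy v i w, baseChange_charClass]
  · intro h
    choose ψ hψ using h
    refine ⟨fun v => charClass K₀ v.abs.Completion (ψ v), fun v i w => ?_⟩
    rw [baseChange_charClass, baseChange_charClass, hψ]

/-! ### The exponents `e_i`, `e(v)`, `e_i(w)` and `e_i(v)` -/

section Exponents

variable {ι : Type*} {K' : ι → IntermediateField k (SeparableClosure k)}

variable [IsMulCommutative Gal(K₀/k)]

theorem expAt_eq_fieldExp (v : Place k) : expAt p K₀ v = fieldExp p K₀ v.abs.Completion :=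
  localExp_eq_fieldExp p (y := AlgHom.id k K₀)
    (eq_top_iff.2 fun x _ => IntermediateField.subset_adjoin _ _ ⟨x, rfl⟩) v.isNontrivial

variable {v : Place k} (i : ι) (w : PlaceOver v.abs (K' i))

theorem expOver_eq_fieldExp : expOver p K₀ K' i w = fieldExp p K₀ w.abs.Completion := by
  exact localExp_eq_fieldExp p (adjoin_range_toCompositum K₀ (K' i))
    (w.isNontrivial v.isNontrivial)

theorem expOver_le_globalExp : expOver p K₀ K' i w ≤ globalExp p K₀ K' i := by
  have := isScalarTower_completion (k := k) w.abs
  rw [expOver_eq_fieldExp, globalExp_eq_fieldExp]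
  exact fieldExp_le_of_algebra _ _

theorem expOver_le_expAt : expOver p K₀ K' i w ≤ expAt p K₀ v := by
  rw [expOver_eq_fieldExp, expAt_eq_fieldExp]
  exact fieldExp_le_of_algebra _ _

theorem expOver_le_expMaxAt : expOver p K₀ K' i w ≤ expMaxAt p K₀ K' v i :=
  le_ciSup (f := fun w => expOver p K₀ K' i w)
    ⟨globalExp p K₀ K' i, Set.forall_mem_range.2 (expOver_le_globalExp i)⟩ w

theorem exists_expOver_eq_expMaxAt (v : Place k) (i : ι) :
    ∃ w : PlaceOver v.abs (K' i), expOver p K₀ K' i w = expMaxAt p K₀ K' v i := by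
  have := nonempty_placeOver (L := K' i) v.isNontrivial
  exact Nat.sSup_mem (Set.range_nonempty fun w => expOver p K₀ K' i w)
    ⟨globalExp p K₀ K' i, Set.forall_mem_range.2 (expOver_le_globalExp i)⟩

end Exponents

/-! ### Local diagonality -/

section LocallyDiagonal

variable {ι : Type*} {K' : ι → IntermediateField k (SeparableClosure k)} {a : SumZMod p K₀ K'}
  {v : Place k}

variable [IsMulCommutative Gal(K₀/k)]

theorem locallyDiagonalAt_iff {s : ℕ}
    (hs : ∀ i (w : PlaceOver v.abs (K' i)), expOver p K₀ K' i w ≤ s) :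
    LocallyDiagonalAt a v ↔ ∃ n : ZMod (p ^ s), ∀ i (w : PlaceOver v.abs (K' i)),
      proj (expOver p K₀ K' i w) n = proj (expOver p K₀ K' i w) (a i) := by
  constructor
  · rintro ⟨n, hn⟩
    obtain ⟨b, hb⟩ := exists_forall_proj_eq s n
    refine ⟨b, fun i w => ?_⟩
    obtain ⟨w', hw'⟩ := exists_expOver_eq_expMaxAt (p := p) (K₀ := K₀) (K' := K') v i
    rw [hb _ (expOver_le_expAt i w) (hs i w)]
    exact proj_eq_proj_of_le (hw' ▸ expOver_le_expAt i w') (hw' ▸ expOver_le_globalExp i w')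
      (expOver_le_expMaxAt i w) (hn i)
  · rintro ⟨b, hb⟩
    obtain ⟨n, hn⟩ := exists_forall_proj_eq (expAt p K₀ v) b
    refine ⟨n, fun i => ?_⟩
    obtain ⟨w, hw⟩ := exists_expOver_eq_expMaxAt (p := p) (K₀ := K₀) (K' := K') v i
    rw [← hw, hn _ (hs i w) (expOver_le_expAt i w), hb]

theorem mem_omegaSet_iff [Fintype ι] {n : ZMod (p ^ maxExp p K₀ K')} :
    v ∈ omegaSet n a ↔ ∀ i (w : PlaceOver v.abs (K' i)),
      proj (expOver p K₀ K' i w) n = proj (expOver p K₀ K' i w) (a i) := by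
  constructor
  · intro h i w
    have hle := expOver_le_globalExp (p := p) (K₀ := K₀) i w
    by_cases hi : i ∈ indexSet n a
    · rw [← proj_proj (globalExp_le_maxExp i) hle, show proj (globalExp p K₀ K' i) n = a i from hi]
    · exact (le_delta_iff hle).1 (h i hi w)
  · exact fun h i _ w => (le_delta_iff (expOver_le_globalExp i w)).2 (h i w)

theorem mem_groupG_iff [Fintype ι] : a ∈ groupG p K₀ K' ↔ ∀ v, LocallyDiagonalAt a v := by
  change (⋃ n, omegaSet n a) = Set.univ ↔ _
  rw [Set.eq_univ_iff_forall]
  refine forall_congr' fun v => ?_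
  rw [locallyDiagonalAt_iff fun i w => (expOver_le_globalExp i w).trans (globalExp_le_maxExp i),
    Set.mem_iUnion]
  exact exists_congr fun n => mem_omegaSet_iff

end LocallyDiagonal

theorem mem_selmerGroup_iff_locallyDiagonalAt (hp : p.Prime)
    (hdeg : Module.finrank k K₀ = p ^ e) [IsCyclic Gal(K₀/k)]
    (γ : (Additive Gal(K₀/k) →+ AddCircle (1 : ℚ)) ≃+ ZMod (p ^ e))
    {ι : Type*} {K' : ι → IntermediateField k (SeparableClosure k)}
    {Φ : ∀ i, GalH1 k K₀ (K' i) ≃+ ZMod (p ^ globalExp p K₀ K' i)}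
    (hΦ : ∀ i χ, Φ i (charClass K₀ (K' i) χ) = proj (globalExp p K₀ K' i) (γ χ))
    (x : ∀ i, GalH1 k K₀ (K' i)) :
    x ∈ selmerGroup k K₀ (fun i => K' i) ↔ ∀ v, LocallyDiagonalAt (fun i => Φ i (x i)) v := by
  have : IsMulCommutative Gal(K₀/k) := IsCyclic.isMulCommutative
  obtain ⟨χ, rfl⟩ : ∃ χ : ι → _, (fun i => charClass K₀ (K' i) (χ i)) = x :=
    ⟨_, funext fun i => (charClass_surjective K₀ (K' i) (x i)).choose_spec⟩
  rw [mem_selmerGroup_charClass_iff]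
  refine forall_congr' fun v => ?_
  rw [locallyDiagonalAt_iff fun i w =>
    (expOver_eq_fieldExp i w).trans_le (fieldExp_le _ hp hdeg), γ.surjective.exists]
  refine exists_congr fun ψ => forall_congr' fun i => forall_congr' fun w => ?_
  have globalExp_le : globalExp p K₀ K' i ≤ e :=
    (globalExp_eq_fieldExp i).trans_le (fieldExp_le _ hp hdeg)
  rw [hΦ, charClass_eq_iff_proj _ hp hdeg γ, ← expOver_eq_fieldExp,
    proj_proj globalExp_le (expOver_le_globalExp i w)]

end

end Multinorm

theorem lemma4p17_general {k : Type u} [Field k] (p e : ℕ) (hp : p.Prime)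
    (K₀ : IntermediateField k (SeparableClosure k)) [FiniteDimensional k K₀] [IsGalois k K₀]
    (hcyc : IsCyclic Gal(K₀/k)) (hdeg : Module.finrank k K₀ = p ^ e)
    {ι : Type*} [Fintype ι] (K' : ι → IntermediateField k (SeparableClosure k))
    (γ : (Additive Gal(K₀/k) →+ AddCircle (1 : ℚ)) ≃+ ZMod (p ^ e)) :
    ∃ (ν : GalH1 k K₀ k ≃+ (Additive Gal(K₀/k) →+ AddCircle (1 : ℚ)))
      (Φ : ∀ i, GalH1 k K₀ (K' i) ≃+ ZMod (p ^ globalExp p K₀ K' i)),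
      (∀ x χ, CorrespondsTo K₀ x χ ↔ ν x = χ) ∧
      (∀ i x, Φ i (baseChange K₀ k (K' i) x) = proj (globalExp p K₀ K' i) (γ (ν x))) ∧
      ((selmerGroup k K₀ (fun i => K' i)).map (AddEquiv.piCongrRight Φ).toAddMonoidHom :
        Set (SumZMod p K₀ K')) = groupG p K₀ K' ∧
      ∀ a, a ∈ groupG p K₀ K' ↔ ∀ v, LocallyDiagonalAt a v := by
  have : IsMulCommutative Gal(K₀/k) := IsCyclic.isMulCommutative
  let N : (Additive Gal(K₀/k) →+ AddCircle (1 : ℚ)) ≃+ GalH1 k K₀ k :=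
    AddEquiv.ofBijective (charClass K₀ k) ⟨charClass_self_injective K₀, charClass_surjective K₀ k⟩
  have exists_Φ (i : ι) : ∃ Φ : GalH1 k K₀ (K' i) ≃+ ZMod (p ^ globalExp p K₀ K' i),
      ∀ χ, Φ (charClass K₀ (K' i) χ) = proj (globalExp p K₀ K' i) (γ χ) := by
    rw [globalExp_eq_fieldExp]
    exact exists_addEquiv_galH1 (K' i) hp hdeg γ
  choose Φ hΦ using exists_Φ
  refine ⟨N.symm, Φ, fun x χ => ?_, fun i x => ?_, Set.ext fun a => ?_, fun a => mem_groupG_iff⟩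
  · rw [correspondsTo_iff_eq_charClass, N.symm_apply_eq]
    rfl
  · obtain ⟨χ, rfl⟩ := N.surjective x
    rw [N.symm_apply_apply, ← hΦ]
    exact congrArg (Φ i) (baseChange_charClass K₀ k χ)
  · obtain ⟨x, rfl⟩ := (AddEquiv.piCongrRight Φ).surjective a
    rw [mem_groupG_iff]
    exact (AddSubgroup.mem_map_iff_mem (AddEquiv.piCongrRight Φ).injective).trans
      (mem_selmerGroup_iff_locallyDiagonalAt hp hdeg γ hΦ x)

theorem lemma4p17 {k : Type u} [Field k] (hk : IsGlobalField k)
    (p e : ℕ) (hp : p.Prime)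
    (K₀ : IntermediateField k (SeparableClosure k)) [FiniteDimensional k K₀] [IsGalois k K₀]
    (hcyc : IsCyclic Gal(K₀/k)) (hdeg : Module.finrank k K₀ = p ^ e)
    (m : ℕ) (K' : Fin m → IntermediateField k (SeparableClosure k))
    [∀ i, FiniteDimensional k (K' i)]
    (γ : (Additive Gal(K₀/k) →+ AddCircle (1 : ℚ)) ≃+ ZMod (p ^ e)) :
    ∃ (ν : GalH1 k K₀ k ≃+ (Additive Gal(K₀/k) →+ AddCircle (1 : ℚ)))
      (Φ : ∀ i, GalH1 k K₀ (K' i) ≃+ ZMod (p ^ globalExp p K₀ K' i)),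
      (∀ x χ, CorrespondsTo K₀ x χ ↔ ν x = χ) ∧
      (∀ i x, Φ i (baseChange K₀ k (K' i) x) = proj (globalExp p K₀ K' i) (γ (ν x))) ∧
      ((selmerGroup k K₀ (fun i => K' i)).map (AddEquiv.piCongrRight Φ).toAddMonoidHom :
        Set (SumZMod p K₀ K')) = groupG p K₀ K' ∧
      ∀ a, a ∈ groupG p K₀ K' ↔ ∀ v, LocallyDiagonalAt a v := by
  exact lemma4p17_general p e hp K₀ hcyc hdeg K' γ
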